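/- Let $k$ be an algebraically closed field of characteristic zero. For a finite group $G$, let $\mathcal Z(G)$ be the monoidal category of finite-dimensional $G$-graded $k$-vector spaces $X=\bigoplus_{g\in G}X_g$ with a $G$-action such that $f(X_g)=X_{fgf^{-1}}$, with the tensor product of graded spaces and the diagonal action. *The algebras.* Let $H\subset G$ be a subgroup, $F\lhd H$ a normal subgroup, $\gamma\in Z^2(F,k^*)$ a normalised 2-cocycle, and $\varepsilon:H\times F\to k^*$, $(h,f)\mapsto\varepsilon_h(f)$, a map such that $$\varepsilon_{gh}(f)=\varepsilon_g(hfh^{-1})\,\varepsilon_h(f)\quad (g,h\in H,\ f\in F),$$ $$\gamma(f,g)\,\varepsilon_h(fg)=\varepsilon_h(f)\,\varepsilon_h(g)\,\gamma(hfh^{-1},hgh^{-1})\quad (h\in H,\ f,g\in F),$$ $$\gamma(f,g)=\varepsilon_f(g)\,\gamma(fgf^{-1},f)\quad (f,g\in F).$$ Then $A(H,F,\gamma,\varepsilon)$ denotes the algebra in $\mathcal Z(G)$ spanned by symbols $a_{g,f}$ ($g\in G$, $f\in F$) modulo the relations $a_{gh,f}=\varepsilon_h(f)\,a_{g,hfh^{-1}}$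 ($h\in H$), with degree $|a_{g,f}|=gfg^{-1}$, action $g'(a_{g,f})=a_{g'g,f}$, and multiplication $a_{g,f}a_{g,f'}=\gamma(f,f')a_{g,ff'}$ and $a_{g,f}a_{g',f'}=0$ if $gH\neq g'H$. Now let $G,Q$ be finite groups, let $U\subset G\times Q$ be a subgroup and let $\gamma\in Z^2(U,k^*)$ be a normalised 2-cocycle. For $x,y\in U$ put $$\gamma(x|y)=\gamma(x,y)\,\gamma(xyx^{-1},x)^{-1}.$$ Let $A(U,\gamma)=A(U,U,\gamma,\gamma(\cdot|\cdot))$, an algebra in $\mathcal Z(G\times Q)\simeq\mathcal Z(G)\boxtimes\mathcal Z(Q)$. *The parent.* The functor $1\boxtimes-:\mathcal Z(Q)\to\mathcal Z(G\times Q)$ is monoidal. Its right adjoint $\mathbf{Hom}_{\mathcal Z(G)}(1,-)$ sends $X$ to the subspace of invariants $\bigl(\bigoplus_{q\in Q}X_{(e,q)}\bigr)^{G\times\{e\}}$ and is lax monoidal as the right adjoint of a monoidal functor; hence it sends algebras in $\mathcal Z(G\times Q)$ to algebras in $\mathcal Z(Q)$. **Theorem.** The parent $\mathbf{Hom}_{\mathcal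 Z(G)}(1,A(U,\gamma))$ is isomorphic, as an algebra in $\mathcal Z(Q)$, to $A(\mathrm{pr}_2(U),K,\gamma|_K,\varepsilon)$. Here $\mathrm{pr}_2(U)\subset Q$ is the projection of $U$ to $Q$; the subgroup $K\subset Q$ (with $v\in Q$ identified with $(e,v)$) is the kernel of the homomorphism $$\overline\gamma:U\cap(\{e\}\times Q)\to \mathrm{Hom}\bigl(U\cap(G\times\{e\}),k^*\bigr),\qquad \overline\gamma(v)(u)=\gamma(v,u)\,\gamma(u,v)^{-1};$$ and $$\varepsilon_q(v)=\gamma\bigl((g,q),v\bigr)\,\gamma\bigl((g,q)v(g,q)^{-1},(g,q)\bigr)^{-1},\qquad q\in \mathrm{pr}_2(U),\ v\in K,$$ for any $g\in G$ with $(g,q)\in U$, the value being independent of the choice of $g$. (In particular $K$ is normal in $\mathrm{pr}_2(U)$, and $\gamma|_K$ and $\varepsilon$ satisfy the three identities above.) -/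

import Mathlib

open CategoryTheory MonoidalCategory TensorProduct

universe u

section Gradings

variable {k : Type*} [Field k] {ι V W : Type*} [AddCommGroup V] [Module k V]
  [AddCommGroup W] [Module k W]

theorem iSupIndep_of_proj (A : ι → Submodule k V) (p : ι → V →ₗ[k] V)
    (h₁ : ∀ i, ∀ x ∈ A i, p i x = x) (h₂ : ∀ i j, i ≠ j → ∀ x ∈ A j, p i x = 0) :
    iSupIndep A := by
  rw [iSupIndep_def]
  intro i
  rw [Submodule.disjoint_def]
  intro x hx hx'
  have hle : (⨆ (j) (_ : j ≠ i), A j) ≤ LinearMap.ker (p i) := by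
    refine iSup₂_le fun j hj y hy => ?_
    exact h₂ i j hj.symm y hy
  rw [← h₁ i x hx]
  exact hle hx'

theorem exists_proj {A : ι → Submodule k V} (hi : iSupIndep A) (hs : iSup A = ⊤) :
    ∃ p : ι → V →ₗ[k] V, (∀ i, ∀ x ∈ A i, p i x = x) ∧
      (∀ i j, i ≠ j → ∀ x ∈ A j, p i x = 0) ∧ ∀ i x, p i x ∈ A i := by
  have hc : ∀ i, IsCompl (A i) (⨆ (j) (_ : j ≠ i), A j) := by
    intro i
    refine ⟨hi i, ?_⟩
    rw [codisjoint_iff, eq_top_iff, ← hs]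
    refine iSup_le fun j => ?_
    by_cases h : j = i
    · subst h; exact le_sup_left
    · exact le_sup_of_le_right (le_iSup₂_of_le j h le_rfl)
  refine ⟨fun i => (A i).projection _ (hc i), ?_, ?_, ?_⟩
  · intro i x hx
    exact Submodule.projection_apply_of_mem_left (hc i) hx
  · intro i j hij x hx
    rw [Submodule.projection_apply_eq_zero_iff]
    exact (le_iSup₂_of_le (f := fun j (_ : j ≠ i) => A j) j hij.symm le_rfl) hx
  · intro i x
    exact Submodule.projection_apply_mem (hc i) x

theorem linearMap_ext_of_iSup {A : ι → Submodule k V} (hs : iSup A = ⊤) {f g : V →ₗ[k] W}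
    (h : ∀ i, ∀ x ∈ A i, f x = g x) : f = g := by
  have : iSup A ≤ LinearMap.eqLocus f g := iSup_le fun i x hx => h i x hx
  ext x
  exact this (hs ▸ Submodule.mem_top)

/-- Gradings can be pushed forward along a map of (finite) index sets. -/
theorem iSupIndep_coarsen {κ : Type*} [Finite ι] {A : ι → Submodule k V} (hi : iSupIndep A)
    (hs : iSup A = ⊤) (π : ι → κ) : iSupIndep fun c => ⨆ (i) (_ : π i = c), A i := by
  classical
  have := Fintype.ofFinite ι
  obtain ⟨p, h₁, h₂, -⟩ := exists_proj hi hs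
  refine iSupIndep_of_proj _ (fun c => ∑ i with π i = c, p i) ?_ ?_
  · intro c x hx
    have : (⨆ (i) (_ : π i = c), A i) ≤
        LinearMap.eqLocus (∑ i with π i = c, p i) LinearMap.id := by
      refine iSup₂_le fun i hic y hy => ?_
      simp only [LinearMap.mem_eqLocus, LinearMap.sum_apply, LinearMap.id_apply]
      rw [Finset.sum_eq_single i, h₁ i y hy]
      · intro j _ hj
        exact h₂ j i hj y hy
      · intro h
        simp [hic] at h
    exact this hx
  · intro c d hcd x hx
    have : (⨆ (i) (_ : π i = d), A i) ≤ LinearMap.ker (∑ i with π i = c, p i) := by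
      refine iSup₂_le fun i hid y hy => ?_
      simp only [LinearMap.mem_ker, LinearMap.sum_apply]
      refine Finset.sum_eq_zero fun j hj => ?_
      simp only [Finset.mem_filter, Finset.mem_univ, true_and] at hj
      refine h₂ j i ?_ y hy
      rintro rfl
      exact hcd (hj.symm.trans hid)
    exact this hx

theorem iSup_coarsen {κ : Type*} {A : ι → Submodule k V}
    (hs : iSup A = ⊤) (π : ι → κ) : (⨆ c, ⨆ (i) (_ : π i = c), A i) = ⊤ := by
  rw [eq_top_iff, ← hs]
  exact iSup_le fun i => le_iSup_of_le (π i) (le_iSup₂_of_le i rfl le_rfl)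

/-- The external tensor product of two gradings: `(V ⊗ W)_{(a,b)} = V_a ⊗ W_b`. -/
def tensorGr {κ : Type*} (A : ι → Submodule k V) (B : κ → Submodule k W) (c : ι × κ) :
    Submodule k (V ⊗[k] W) :=
  Submodule.map₂ (TensorProduct.mk k V W) (A c.1) (B c.2)

theorem tmul_mem_tensorGr {κ : Type*} {A : ι → Submodule k V} {B : κ → Submodule k W}
    {a : ι} {b : κ} {x : V} {y : W} (hx : x ∈ A a) (hy : y ∈ B b) :
    x ⊗ₜ[k] y ∈ tensorGr A B (a, b) :=
  Submodule.apply_mem_map₂ (TensorProduct.mk k V W) hx hy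

theorem iSupIndep_tensorGr {κ : Type*} {A : ι → Submodule k V} {B : κ → Submodule k W}
    (hA : iSupIndep A) (hA' : iSup A = ⊤) (hB : iSupIndep B) (hB' : iSup B = ⊤) :
    iSupIndep (tensorGr A B) := by
  obtain ⟨p, p₁, p₂, -⟩ := exists_proj hA hA'
  obtain ⟨q, q₁, q₂, -⟩ := exists_proj hB hB'
  refine iSupIndep_of_proj _ (fun c => TensorProduct.map (p c.1) (q c.2)) ?_ ?_
  · intro c x hx
    have : tensorGr A B c ≤ LinearMap.eqLocus (TensorProduct.map (p c.1) (q c.2))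
        LinearMap.id := by
      refine Submodule.map₂_le.2 fun m hm n hn => ?_
      simp [p₁ _ m hm, q₁ _ n hn]
    exact this hx
  · intro c d hcd x hx
    have : tensorGr A B d ≤ LinearMap.ker (TensorProduct.map (p c.1) (q c.2)) := by
      refine Submodule.map₂_le.2 fun m hm n hn => ?_
      by_cases h : c.1 = d.1
      · have h' : c.2 ≠ d.2 := fun h' => hcd (Prod.ext h h')
        simp [q₂ _ _ h' n hn]
      · simp [p₂ _ _ h m hm]
    exact this hx

theorem iSup_tensorGr {κ : Type*} {A : ι → Submodule k V} {B : κ → Submodule k W}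
    (hA : iSup A = ⊤) (hB : iSup B = ⊤) : iSup (tensorGr A B) = ⊤ := by
  have : iSup (tensorGr A B) = Submodule.map₂ (TensorProduct.mk k V W) (iSup A) (iSup B) := by
    rw [Submodule.map₂_iSup_left, iSup_prod]
    refine iSup_congr fun i => ?_
    rw [Submodule.map₂_iSup_right]
    rfl
  rw [this, hA, hB]
  exact TensorProduct.map₂_mk_top_top_eq_top k V W

end Gradings

/-- An object of the category `Z(G)`: a finite dimensional `G`-graded vector space
`V = ⨁ V_g` with a compatible action of `G`, i.e. `f (V_g) = V_{f g f⁻¹}`.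
(The inclusion `f (V_g) ⊆ V_{f g f⁻¹}` for all `f` gives equality, `f` being invertible.) -/
structure ZCat (k G : Type u) [Field k] [Group G] where
  /-- the underlying vector space -/
  carrier : Type u
  [addCommGroup : AddCommGroup carrier]
  [module : Module k carrier]
  [finite : FiniteDimensional k carrier]
  /-- the homogeneous components -/
  gr : G → Submodule k carrier
  /-- the action of `G` -/
  act : Representation k G carrier
  indep : iSupIndep gr
  iSup_eq_top : iSup gr = ⊤
  act_mem : ∀ (f g : G) (x : carrier), x ∈ gr g → act f x ∈ gr (f * g * f⁻¹)

namespace ZCat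

attribute [instance] ZCat.addCommGroup ZCat.module ZCat.finite

section Basic

variable {k G : Type u} [Field k] [Group G]

instance : CoeSort (ZCat k G) (Type u) := ⟨ZCat.carrier⟩

/-- Morphisms of `Z(G)`: linear maps preserving the grading and the action. -/
@[ext]
structure Hom (X Y : ZCat k G) where
  /-- the underlying linear map -/
  lin : X →ₗ[k] Y
  map_gr : ∀ (g : G) (x : X), x ∈ X.gr g → lin x ∈ Y.gr g
  map_act : ∀ (g : G) (x : X), lin (X.act g x) = Y.act g (lin x)

instance : Category (ZCat k G) where
  Hom := Hom
  id X := ⟨LinearMap.id, fun _ _ h => h, fun _ _ => rfl⟩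
  comp f g := ⟨g.lin ∘ₗ f.lin, fun a x h => g.map_gr a _ (f.map_gr a x h),
    fun a x => by simp [f.map_act, g.map_act]⟩

@[simp] theorem id_lin (X : ZCat k G) : Hom.lin (𝟙 X) = LinearMap.id := rfl

@[simp] theorem comp_lin {X Y Z : ZCat k G} (f : X ⟶ Y) (g : Y ⟶ Z) :
    Hom.lin (f ≫ g) = Hom.lin g ∘ₗ Hom.lin f := rfl

theorem hom_ext {X Y : ZCat k G} {f g : X ⟶ Y} (h : Hom.lin f = Hom.lin g) : f = g :=
  Hom.ext h

/-- A linear isomorphism preserving grading and action is an isomorphism of `Z(G)`. -/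
def isoOfEquiv {X Y : ZCat k G} (e : X ≃ₗ[k] Y) (h : ∀ (g : G) (x : X), x ∈ X.gr g → e x ∈ Y.gr g)
    (h' : ∀ (g : G) (y : Y), y ∈ Y.gr g → e.symm y ∈ X.gr g)
    (ha : ∀ (g : G) (x : X), e (X.act g x) = Y.act g (e x)) : X ≅ Y where
  hom := ⟨e.toLinearMap, h, ha⟩
  inv := ⟨e.symm.toLinearMap, h', fun g y => by
    apply e.injective
    simp [ha]⟩
  hom_inv_id := hom_ext (by ext x; simp)
  inv_hom_id := hom_ext (by ext x; simp)

/-- The monoidal unit: the field `k` in degree `e` with trivial action. -/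
def unitObj (k G : Type u) [Field k] [Group G] : ZCat k G where
  carrier := k
  gr g := ⨆ _ : g = 1, ⊤
  act := 1
  indep := by
    classical
    refine iSupIndep_of_proj _ (fun g => if g = 1 then LinearMap.id else 0) ?_ ?_
    · intro g x hx
      by_cases h : g = 1
      · simp [h]
      · simp only [h, iSup_false, Submodule.mem_bot] at hx
        simp [hx]
    · intro g h hgh x hx
      by_cases h1 : h = 1
      · have : g ≠ 1 := fun h2 => hgh (h2.trans h1.symm)
        simp [this]
      · simp only [h1, iSup_false, Submodule.mem_bot] at hx
        simp [hx]
  iSup_eq_top := by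
    rw [eq_top_iff]
    exact le_iSup_of_le 1 (le_iSup_of_le rfl le_rfl)
  act_mem f g x hx := by
    by_cases h : g = 1
    · simp [h]
    · simp only [h, iSup_false, Submodule.mem_bot] at hx
      simp [hx]

theorem mem_unitObj_one (x : k) : x ∈ (unitObj k G).gr 1 := by
  change x ∈ (⨆ _ : (1 : G) = 1, (⊤ : Submodule k k))
  simp

theorem eq_zero_or_of_mem_unitObj {g : G} {x : k} (hx : x ∈ (unitObj k G).gr g) :
    g = 1 ∨ x = 0 := by
  by_cases h : g = 1
  · exact Or.inl h
  · change x ∈ (⨆ _ : g = 1, (⊤ : Submodule k k)) at hx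
    simp only [h, iSup_false, Submodule.mem_bot] at hx
    exact Or.inr hx

end Basic

section External

variable {k G Q : Type u} [Field k] [Group G] [Group Q]

/-- The external tensor product `X ⊠ Y`, an object of `Z(G × Q)`, of `X` in `Z(G)` and
`Y` in `Z(Q)`: the vector space `X ⊗ Y` with the grading `(X ⊠ Y)_{(g,q)} = X_g ⊗ Y_q` and
the action `(g,q)(x ⊗ y) = g(x) ⊗ q(y)`. -/
noncomputable def box (X : ZCat k G) (Y : ZCat k Q) : ZCat k (G × Q) where
  carrier := X ⊗[k] Y
  gr := tensorGr X.gr Y.gr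
  act :=
    { toFun := fun c => TensorProduct.map (X.act c.1) (Y.act c.2)
      map_one' := by simp [TensorProduct.map_one]
      map_mul' := fun c d => by simp [TensorProduct.map_mul] }
  indep := iSupIndep_tensorGr X.indep X.iSup_eq_top Y.indep Y.iSup_eq_top
  iSup_eq_top := iSup_tensorGr X.iSup_eq_top Y.iSup_eq_top
  act_mem f g x hx := by
    have : tensorGr X.gr Y.gr g ≤ (tensorGr X.gr Y.gr (f * g * f⁻¹)).comap
        (TensorProduct.map (X.act f.1) (Y.act f.2)) := by
      refine Submodule.map₂_le.2 fun m hm n hn => ?_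
      exact tmul_mem_tensorGr (X.act_mem _ _ _ hm) (Y.act_mem _ _ _ hn)
    exact this hx

end External

section Monoidal

variable {k G : Type u} [Field k] [Group G] [Finite G]

/-- The tensor product of `Z(G)`: the tensor product of graded vector spaces,
`(X ⊗ Y)_g = ⨁_{ab = g} X_a ⊗ Y_b`, with the diagonal action. -/
noncomputable def tensor (X Y : ZCat k G) : ZCat k G where
  carrier := X ⊗[k] Y
  gr g := ⨆ (c : G × G) (_ : c.1 * c.2 = g), tensorGr X.gr Y.gr c
  act := X.act.tprod Y.act
  indep := iSupIndep_coarsen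
    (iSupIndep_tensorGr X.indep X.iSup_eq_top Y.indep Y.iSup_eq_top)
    (iSup_tensorGr X.iSup_eq_top Y.iSup_eq_top) _
  iSup_eq_top := iSup_coarsen (iSup_tensorGr X.iSup_eq_top Y.iSup_eq_top) _
  act_mem f g x hx := by
    have : (⨆ (c : G × G) (_ : c.1 * c.2 = g), tensorGr X.gr Y.gr c) ≤
        (⨆ (c : G × G) (_ : c.1 * c.2 = f * g * f⁻¹), tensorGr X.gr Y.gr c).comap
          (TensorProduct.map (X.act f) (Y.act f)) := by
      refine iSup₂_le fun c hc => Submodule.map₂_le.2 fun m hm n hn => ?_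
      refine Submodule.mem_iSup_of_mem (f * c.1 * f⁻¹, f * c.2 * f⁻¹)
        (Submodule.mem_iSup_of_mem (by simp [← hc, mul_assoc]) ?_)
      exact tmul_mem_tensorGr (X.act_mem _ _ _ hm) (Y.act_mem _ _ _ hn)
    exact this hx

theorem tmul_mem {X Y : ZCat k G} {a b g : G} (h : a * b = g) {x : X} {y : Y}
    (hx : x ∈ X.gr a) (hy : y ∈ Y.gr b) : x ⊗ₜ[k] y ∈ (tensor X Y).gr g :=
  Submodule.mem_iSup_of_mem (a, b) (Submodule.mem_iSup_of_mem h (tmul_mem_tensorGr hx hy))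

theorem tensor_gr_le {X Y : ZCat k G} {g : G} {S : Submodule k (X ⊗[k] Y)}
    (h : ∀ a b : G, a * b = g → ∀ x ∈ X.gr a, ∀ y ∈ Y.gr b, x ⊗ₜ[k] y ∈ S) :
    (tensor X Y).gr g ≤ S :=
  iSup₂_le fun c hc => Submodule.map₂_le.2 fun m hm n hn => h c.1 c.2 hc m hm n hn

theorem tensor_act {X Y : ZCat k G} (g : G) :
    (tensor X Y).act g = TensorProduct.map (X.act g) (Y.act g) := rfl

@[simp] theorem tensor_act_tmul {X Y : ZCat k G} (g : G) (x : X) (y : Y) :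
    (tensor X Y).act g (x ⊗ₜ[k] y) = X.act g x ⊗ₜ[k] Y.act g y := rfl

/-- A morphism out of a tensor product, from a linear map compatible with the
structure on pure tensors. -/
def homOfTensor {X Y Z : ZCat k G} (f : X ⊗[k] Y →ₗ[k] Z)
    (hg : ∀ a b : G, ∀ x ∈ X.gr a, ∀ y ∈ Y.gr b, f (x ⊗ₜ[k] y) ∈ Z.gr (a * b))
    (ha : ∀ (g : G) (x : X) (y : Y), f (X.act g x ⊗ₜ[k] Y.act g y) = Z.act g (f (x ⊗ₜ[k] y))) :
    tensor X Y ⟶ Z where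
  lin := f
  map_gr g := by
    have : (tensor X Y).gr g ≤ (Z.gr g).comap f :=
      tensor_gr_le fun a b h x hx y hy => by
        subst h
        exact hg a b x hx y hy
    exact fun x hx => this hx
  map_act g := by
    have : f ∘ₗ (tensor X Y).act g = Z.act g ∘ₗ f := TensorProduct.ext' fun x y => ha g x y
    exact fun x => LinearMap.congr_fun this x

noncomputable def tensorMap {X X' Y Y' : ZCat k G} (f : X ⟶ X') (g : Y ⟶ Y') :
    tensor X Y ⟶ tensor X' Y' :=
  homOfTensor (Z := tensor X' Y') (TensorProduct.map f.lin g.lin)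
    (fun a b x hx y hy => tmul_mem rfl (f.map_gr a x hx) (g.map_gr b y hy))
    (fun a x y => by
      change f.lin (X.act a x) ⊗ₜ[k] g.lin (Y.act a y) = _
      rw [f.map_act, g.map_act]; rfl)

noncomputable def assocIso (X Y Z : ZCat k G) :
    tensor (tensor X Y) Z ≅ tensor X (tensor Y Z) :=
  isoOfEquiv (X := tensor (tensor X Y) Z) (Y := tensor X (tensor Y Z))
    (TensorProduct.assoc k X Y Z)
    (fun g => by
      have : (tensor (tensor X Y) Z).gr g ≤ ((tensor X (tensor Y Z)).gr g).comap
          (TensorProduct.assoc k X Y Z).toLinearMap := by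
        refine tensor_gr_le fun a c h t ht z hz => ?_
        have h2 : (tensor X Y).gr a ≤ (((tensor X (tensor Y Z)).gr g).comap
            (TensorProduct.assoc k X Y Z).toLinearMap).comap
              ((TensorProduct.mk k (X ⊗[k] Y) Z).flip z) := by
          refine tensor_gr_le fun a' b' h' x hx y hy => ?_
          exact tmul_mem (a := a') (b := b' * c) (by rw [← h, ← h', mul_assoc]) hx
            (tmul_mem rfl hy hz)
        exact h2 ht
      exact fun x hx => this hx)
    (fun g => by
      have : (tensor X (tensor Y Z)).gr g ≤ ((tensor (tensor X Y) Z).gr g).comap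
          (TensorProduct.assoc k X Y Z).symm.toLinearMap := by
        refine tensor_gr_le fun a c h x hx t ht => ?_
        have h2 : (tensor Y Z).gr c ≤ (((tensor (tensor X Y) Z).gr g).comap
            (TensorProduct.assoc k X Y Z).symm.toLinearMap).comap
              (TensorProduct.mk k X (Y ⊗[k] Z) x) := by
          refine tensor_gr_le fun b' c' h' y hy z hz => ?_
          exact tmul_mem (a := a * b') (b := c') (by rw [← h, ← h', mul_assoc])
            (tmul_mem rfl hx hy) hz
        exact h2 ht
      exact fun x hx => this hx)
    (fun g => by
      have : (TensorProduct.assoc k X Y Z).toLinearMap ∘ₗ (tensor (tensor X Y) Z).act g =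
          (tensor X (tensor Y Z)).act g ∘ₗ (TensorProduct.assoc k X Y Z).toLinearMap :=
        TensorProduct.ext_threefold fun x y z => rfl
      exact fun x => LinearMap.congr_fun this x)

noncomputable def leftUnitIso (X : ZCat k G) : tensor (unitObj k G) X ≅ X :=
  isoOfEquiv (X := tensor (unitObj k G) X) (TensorProduct.lid k X)
    (fun g => by
      have : (tensor (unitObj k G) X).gr g ≤ (X.gr g).comap
          (TensorProduct.lid k X).toLinearMap := by
        refine tensor_gr_le fun a b h (r : k) hr x hx => ?_
        change (TensorProduct.lid k X) (r ⊗ₜ[k] x) ∈ X.gr g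
        rw [TensorProduct.lid_tmul]
        rcases eq_zero_or_of_mem_unitObj (k := k) hr with rfl | rfl
        · rw [one_mul] at h
          subst h
          exact Submodule.smul_mem _ _ hx
        · simp
      exact fun x hx => this hx)
    (fun g _ hx => tmul_mem (X := unitObj k G) (one_mul g) (mem_unitObj_one (k := k) 1) hx)
    (fun g => by
      have : (TensorProduct.lid k X).toLinearMap ∘ₗ (tensor (unitObj k G) X).act g =
          X.act g ∘ₗ (TensorProduct.lid k X).toLinearMap := by
        refine TensorProduct.ext' fun (r : k) x => ?_
        change r • X.act g x = X.act g (r • x)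
        rw [map_smul]
      exact fun x => LinearMap.congr_fun this x)

noncomputable def rightUnitIso (X : ZCat k G) : tensor X (unitObj k G) ≅ X :=
  isoOfEquiv (X := tensor X (unitObj k G)) (TensorProduct.rid k X)
    (fun g => by
      have : (tensor X (unitObj k G)).gr g ≤ (X.gr g).comap
          (TensorProduct.rid k X).toLinearMap := by
        refine tensor_gr_le fun a b h x hx (r : k) hr => ?_
        change (TensorProduct.rid k X) (x ⊗ₜ[k] r) ∈ X.gr g
        rw [TensorProduct.rid_tmul]
        rcases eq_zero_or_of_mem_unitObj (k := k) hr with rfl | rfl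
        · rw [mul_one] at h
          subst h
          exact Submodule.smul_mem _ _ hx
        · simp
      exact fun x hx => this hx)
    (fun g _ hx => tmul_mem (Y := unitObj k G) (mul_one g) hx (mem_unitObj_one (k := k) 1))
    (fun g => by
      have : (TensorProduct.rid k X).toLinearMap ∘ₗ (tensor X (unitObj k G)).act g =
          X.act g ∘ₗ (TensorProduct.rid k X).toLinearMap := by
        refine TensorProduct.ext' fun x (r : k) => ?_
        change r • X.act g x = X.act g (r • x)
        rw [map_smul]
      exact fun x => LinearMap.congr_fun this x)

noncomputable instance : MonoidalCategoryStruct (ZCat k G) where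
  tensorObj := tensor
  whiskerLeft X _ _ f := tensorMap (𝟙 X) f
  whiskerRight f Y := tensorMap f (𝟙 Y)
  tensorHom := tensorMap
  tensorUnit := unitObj k G
  associator := assocIso
  leftUnitor := leftUnitIso
  rightUnitor := rightUnitIso

noncomputable instance : MonoidalCategory (ZCat k G) := MonoidalCategory.ofTensorHom
  (id_tensorHom_id := fun X Y => hom_ext (TensorProduct.ext' fun _ _ => rfl))
  (tensorHom_comp_tensorHom := fun _ _ _ _ => hom_ext (TensorProduct.ext' fun _ _ => rfl))
  (associator_naturality := fun _ _ _ =>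
    hom_ext (TensorProduct.ext_threefold fun _ _ _ => rfl))
  (leftUnitor_naturality := fun f => hom_ext (TensorProduct.ext' fun (r : k) x =>
    (map_smul f.lin r x).symm))
  (rightUnitor_naturality := fun f => hom_ext (TensorProduct.ext' fun x (r : k) =>
    (map_smul f.lin r x).symm))
  (pentagon := fun _ _ _ _ => hom_ext (TensorProduct.ext_fourfold fun _ _ _ _ => rfl))
  (triangle := fun _ _ => hom_ext (TensorProduct.ext_threefold fun _ _ _ =>
    TensorProduct.tmul_smul _ _ _))

end Monoidal

section Parent

variable {k G Q : Type u} [Field k] [Group G] [Group Q]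

theorem box_gr_le {X : ZCat k G} {Y : ZCat k Q} {c : G × Q} {S : Submodule k (X ⊗[k] Y)}
    (h : ∀ x ∈ X.gr c.1, ∀ y ∈ Y.gr c.2, x ⊗ₜ[k] y ∈ S) : (box X Y).gr c ≤ S :=
  Submodule.map₂_le.2 fun m hm n hn => h m hm n hn

theorem tmul_mem_box {X : ZCat k G} {Y : ZCat k Q} {c : G × Q} {x : X} {y : Y}
    (hx : x ∈ X.gr c.1) (hy : y ∈ Y.gr c.2) : x ⊗ₜ[k] y ∈ (box X Y).gr c :=
  tmul_mem_tensorGr hx hy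

/-- The functor `X ⊠ - : Z(Q) ⥤ Z(G × Q)`. -/
noncomputable def boxFunctor (X : ZCat k G) : ZCat k Q ⥤ ZCat k (G × Q) where
  obj Y := box X Y
  map {Y Y'} f :=
    { lin := TensorProduct.map LinearMap.id f.lin
      map_gr := fun c => by
        have : (box X Y).gr c ≤ ((box X Y').gr c).comap
            (TensorProduct.map LinearMap.id f.lin) :=
          box_gr_le fun x hx y hy => tmul_mem_box hx (f.map_gr _ y hy)
        exact fun x hx => this hx
      map_act := fun c => by
        have : TensorProduct.map LinearMap.id f.lin ∘ₗ (box X Y).act c =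
            (box X Y').act c ∘ₗ TensorProduct.map LinearMap.id f.lin := by
          refine TensorProduct.ext' fun x y => ?_
          change X.act c.1 x ⊗ₜ[k] f.lin (Y.act c.2 y) = X.act c.1 x ⊗ₜ[k] Y'.act c.2 (f.lin y)
          rw [f.map_act]
        exact fun x => LinearMap.congr_fun this x }
  map_id Y := hom_ext (TensorProduct.ext' fun _ _ => rfl)
  map_comp f g := hom_ext (TensorProduct.ext' fun _ _ => rfl)

variable (k G Q) in
/-- The functor `1 ⊠ - : Z(Q) ⥤ Z(G × Q)`, with `1` the monoidal unit of `Z(G)`. -/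
noncomputable def oneBox : ZCat k Q ⥤ ZCat k (G × Q) := boxFunctor (unitObj k G)

theorem one_tensor_ext {V W : Type*} [AddCommGroup V] [Module k V] [AddCommGroup W]
    [Module k W] {f g : k ⊗[k] V →ₗ[k] W} (h : ∀ x, f (1 ⊗ₜ x) = g (1 ⊗ₜ x)) : f = g :=
  TensorProduct.ext (LinearMap.ext_ring (LinearMap.ext h))

theorem one_tensor_ext₂ {V V' W : Type*} [AddCommGroup V] [Module k V] [AddCommGroup V']
    [Module k V'] [AddCommGroup W] [Module k W]
    {f g : (k ⊗[k] V) ⊗[k] (k ⊗[k] V') →ₗ[k] W}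
    (h : ∀ x y, f ((1 ⊗ₜ x) ⊗ₜ (1 ⊗ₜ y)) = g ((1 ⊗ₜ x) ⊗ₜ (1 ⊗ₜ y))) : f = g :=
  TensorProduct.ext (one_tensor_ext fun x => one_tensor_ext fun y => h x y)

theorem one_tensor_ext₃ {V V' V'' W : Type*} [AddCommGroup V] [Module k V] [AddCommGroup V']
    [Module k V'] [AddCommGroup V''] [Module k V''] [AddCommGroup W] [Module k W]
    {f g : ((k ⊗[k] V) ⊗[k] (k ⊗[k] V')) ⊗[k] (k ⊗[k] V'') →ₗ[k] W}
    (h : ∀ x y z, f (((1 ⊗ₜ x) ⊗ₜ (1 ⊗ₜ y)) ⊗ₜ (1 ⊗ₜ z)) =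
      g (((1 ⊗ₜ x) ⊗ₜ (1 ⊗ₜ y)) ⊗ₜ (1 ⊗ₜ z))) : f = g :=
  TensorProduct.ext (one_tensor_ext₂ fun x y => one_tensor_ext fun z => h x y z)

/-- The linear isomorphism `(k ⊗ V) ⊗ (k ⊗ W) ≃ k ⊗ (V ⊗ W)`. -/
noncomputable def oneTensorEquiv (k V W : Type*) [Field k] [AddCommGroup V] [Module k V]
    [AddCommGroup W] [Module k W] : (k ⊗[k] V) ⊗[k] (k ⊗[k] W) ≃ₗ[k] k ⊗[k] (V ⊗[k] W) :=
  (TensorProduct.tensorTensorTensorComm k k V k W).trans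
    (TensorProduct.congr (TensorProduct.lid k k) (LinearEquiv.refl k (V ⊗[k] W)))

theorem oneTensorEquiv_tmul {V W : Type*} [AddCommGroup V] [Module k V]
    [AddCommGroup W] [Module k W] (r s : k) (x : V) (y : W) :
    oneTensorEquiv k V W ((r ⊗ₜ x) ⊗ₜ (s ⊗ₜ y)) = (r * s) ⊗ₜ (x ⊗ₜ y) := rfl

theorem oneTensorEquiv_symm_tmul {V W : Type*} [AddCommGroup V] [Module k V]
    [AddCommGroup W] [Module k W] (r : k) (x : V) (y : W) :
    (oneTensorEquiv k V W).symm (r ⊗ₜ (x ⊗ₜ y)) = (r ⊗ₜ x) ⊗ₜ (1 ⊗ₜ y) := by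
  rw [LinearEquiv.symm_apply_eq, oneTensorEquiv_tmul, mul_one]

variable [Finite G] [Finite Q]

/-- The isomorphism `1 ≅ 1 ⊠ 1`. -/
noncomputable def oneBoxUnitIso : 𝟙_ (ZCat k (G × Q)) ≅ (oneBox k G Q).obj (𝟙_ (ZCat k Q)) :=
  isoOfEquiv (X := unitObj k (G × Q)) (Y := box (unitObj k G) (unitObj k Q))
    (TensorProduct.lid k k).symm
    (fun c (r : k) hr => by
      change (1 : k) ⊗ₜ[k] r ∈ _
      rcases eq_zero_or_of_mem_unitObj (k := k) hr with rfl | rfl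
      · exact tmul_mem_box (X := unitObj k G) (Y := unitObj k Q) (mem_unitObj_one (k := k) 1)
          (mem_unitObj_one (k := k) r)
      · rw [TensorProduct.tmul_zero]
        exact Submodule.zero_mem _)
    (fun c => by
      have : (box (unitObj k G) (unitObj k Q)).gr c ≤ ((unitObj k (G × Q)).gr c).comap
          (TensorProduct.lid k k).toLinearMap := by
        refine box_gr_le fun (r : k) hr (s : k) hs => ?_
        change r * s ∈ (unitObj k (G × Q)).gr c
        rcases eq_zero_or_of_mem_unitObj (k := k) hr with h | rfl
        · rcases eq_zero_or_of_mem_unitObj (k := k) hs with h' | rfl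
          · obtain rfl : c = 1 := Prod.ext h h'
            exact mem_unitObj_one (k := k) _
          · rw [mul_zero]
            exact Submodule.zero_mem _
        · rw [zero_mul]
          exact Submodule.zero_mem _
      exact fun x hx => this hx)
    (fun _ _ => rfl)

/-- The isomorphism `(1 ⊠ X) ⊗ (1 ⊠ Y) ≅ 1 ⊠ (X ⊗ Y)`. -/
noncomputable def oneBoxTensorIso (X Y : ZCat k Q) :
    (oneBox k G Q).obj X ⊗ (oneBox k G Q).obj Y ≅ (oneBox k G Q).obj (X ⊗ Y) :=
  isoOfEquiv (X := tensor (box (unitObj k G) X) (box (unitObj k G) Y))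
    (Y := box (unitObj k G) (tensor X Y)) (oneTensorEquiv k X Y)
    (fun c => by
      have : (tensor (box (unitObj k G) X) (box (unitObj k G) Y)).gr c ≤
          ((box (unitObj k G) (tensor X Y)).gr c).comap
            (oneTensorEquiv k X Y).toLinearMap := by
        refine tensor_gr_le fun a b h t ht s hs => ?_
        have h2 : (box (unitObj k G) X).gr a ≤ (((box (unitObj k G) (tensor X Y)).gr c).comap
            (oneTensorEquiv k X Y).toLinearMap).comap
              ((TensorProduct.mk k (k ⊗[k] X) (k ⊗[k] Y)).flip s) := by
          refine box_gr_le fun (p : k) hp x hx => ?_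
          have h3 : (box (unitObj k G) Y).gr b ≤
              (((box (unitObj k G) (tensor X Y)).gr c).comap
                (oneTensorEquiv k X Y).toLinearMap).comap
                  (TensorProduct.mk k (k ⊗[k] X) (k ⊗[k] Y) (p ⊗ₜ x)) := by
            refine box_gr_le fun (q : k) hq y hy => ?_
            change (p * q) ⊗ₜ[k] (x ⊗ₜ[k] y) ∈ (box (unitObj k G) (tensor X Y)).gr c
            rcases eq_zero_or_of_mem_unitObj (k := k) hp with ha | rfl
            · rcases eq_zero_or_of_mem_unitObj (k := k) hq with hb | rfl
              · refine tmul_mem_box (X := unitObj k G) ?_ (tmul_mem ?_ hx hy)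
                · have : c.1 = 1 := by rw [← h]; simp [ha, hb]
                  rw [this]
                  exact mem_unitObj_one (k := k) _
                · rw [← h]; rfl
              · rw [mul_zero, TensorProduct.zero_tmul]
                exact Submodule.zero_mem _
            · rw [zero_mul, TensorProduct.zero_tmul]
              exact Submodule.zero_mem _
          exact h3 hs
        exact h2 ht
      exact fun x hx => this hx)
    (fun c => by
      have : (box (unitObj k G) (tensor X Y)).gr c ≤
          ((tensor (box (unitObj k G) X) (box (unitObj k G) Y)).gr c).comap
            (oneTensorEquiv k X Y).symm.toLinearMap := by
        refine box_gr_le fun (p : k) hp t ht => ?_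
        have h2 : (tensor X Y).gr c.2 ≤
            (((tensor (box (unitObj k G) X) (box (unitObj k G) Y)).gr c).comap
              (oneTensorEquiv k X Y).symm.toLinearMap).comap
                (TensorProduct.mk k k (X ⊗[k] Y) p) := by
          refine tensor_gr_le fun a b h x hx y hy => ?_
          change (oneTensorEquiv k X Y).symm (p ⊗ₜ (x ⊗ₜ y)) ∈
            (tensor (box (unitObj k G) X) (box (unitObj k G) Y)).gr c
          rw [oneTensorEquiv_symm_tmul]
          exact tmul_mem (a := (c.1, a)) (b := ((1 : G), b))
            (Prod.ext (mul_one c.1) (by simpa using h)) (tmul_mem_box (X := unitObj k G) hp hx)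
            (tmul_mem_box (X := unitObj k G) (mem_unitObj_one (k := k) 1) hy)
        exact h2 ht
      exact fun x hx => this hx)
    (fun c => by
      have : (oneTensorEquiv k X Y).toLinearMap ∘ₗ
          (tensor (box (unitObj k G) X) (box (unitObj k G) Y)).act c =
          (box (unitObj k G) (tensor X Y)).act c ∘ₗ (oneTensorEquiv k X Y).toLinearMap :=
        one_tensor_ext₂ fun x y => rfl
      exact fun x => LinearMap.congr_fun this x)

/-- The functor `1 ⊠ -` is monoidal. -/
noncomputable instance : (oneBox k G Q).Monoidal :=
  Functor.CoreMonoidal.toMonoidal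
    { εIso := oneBoxUnitIso
      μIso := oneBoxTensorIso
      μIso_hom_natural_left := fun _ _ => hom_ext (one_tensor_ext₂ fun _ _ => rfl)
      μIso_hom_natural_right := fun _ _ => hom_ext (one_tensor_ext₂ fun _ _ => rfl)
      associativity := fun X Y Z => hom_ext (one_tensor_ext₃ fun x y z => by
        change ((1 : k) * 1 * 1) ⊗ₜ[k] (x ⊗ₜ[k] (y ⊗ₜ[k] z)) =
          ((1 : k) * (1 * 1)) ⊗ₜ[k] (x ⊗ₜ[k] (y ⊗ₜ[k] z))
        rw [mul_assoc])
      left_unitality := fun X => hom_ext (TensorProduct.ext (LinearMap.ext_ring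
        (one_tensor_ext fun x => by
          change (1 : k) • ((1 : k) ⊗ₜ[k] x) = ((1 : k) * 1) ⊗ₜ[k] ((1 : k) • x)
          simp)))
      right_unitality := fun X => hom_ext (TensorProduct.ext (one_tensor_ext fun x =>
        LinearMap.ext_ring (by
          change (1 : k) • ((1 : k) ⊗ₜ[k] x) = ((1 : k) * 1) ⊗ₜ[k] ((1 : k) • x)
          simp))) }

end Parent

section Invariants

variable {k G Q : Type u} [Field k] [Group G] [Group Q]

/-- The subspace `(⨁_{q} X_{(e,q)})^{G × {e}}` of `X`. -/
noncomputable def homOneSub (X : ZCat k (G × Q)) : Submodule k X :=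
  (⨆ q : Q, X.gr (1, q)) ⊓ Representation.invariants (X.act.comp (MonoidHom.inl G Q))

theorem act_eq_of_mem_homOneSub {X : ZCat k (G × Q)} {x : X} (hx : x ∈ homOneSub X) (g : G) :
    X.act (g, 1) x = x :=
  (Representation.mem_invariants _ _).1 hx.2 g

theorem mem_homOneSub_of_gr {X : ZCat k (G × Q)} {x : X} {q : Q} (hx : x ∈ X.gr (1, q))
    (h : ∀ g : G, X.act (g, 1) x = x) : x ∈ homOneSub X :=
  ⟨Submodule.mem_iSup_of_mem q hx, (Representation.mem_invariants _ _).2 h⟩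

theorem iSup_homOneSub (X : ZCat k (G × Q)) :
    (⨆ q : Q, (X.gr (1, q)).comap (homOneSub X).subtype) = ⊤ := by
  classical
  obtain ⟨p, p₁, p₂, p₃⟩ := exists_proj X.indep X.iSup_eq_top
  have hcomm : ∀ (g : G) (q : Q), X.act (g, 1) ∘ₗ p (1, q) = p (1, q) ∘ₗ X.act (g, 1) := by
    intro g q
    refine linearMap_ext_of_iSup X.iSup_eq_top fun c x hx => ?_
    have hgx := X.act_mem (g, 1) c x hx
    by_cases hc : c = (1, q)
    · subst hc
      have : ((g, 1) * (1, q) * (g, 1)⁻¹ : G × Q) = (1, q) := by ext <;> simp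
      rw [this] at hgx
      simp [p₁ _ _ hx, p₁ _ _ hgx]
    · have : ((1, q) : G × Q) ≠ (g, 1) * c * (g, 1)⁻¹ := by
        intro h
        apply hc
        have h' := (eq_mul_inv_iff_mul_eq.1 h)
        have h1 := congrArg Prod.fst h'
        have h2 := congrArg Prod.snd h'
        ext
        · simpa using h1.symm
        · simpa using h2.symm
      simp [p₂ _ _ (Ne.symm hc) _ hx, p₂ _ _ this _ hgx]
  rw [eq_top_iff]
  rintro ⟨x, hx⟩ -
  have hx1 : x ∈ ⨆ q : Q, X.gr (1, q) := hx.1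
  rw [Submodule.mem_iSup_iff_exists_finsupp] at hx1
  obtain ⟨f, hf, hfx⟩ := hx1
  have hp : ∀ q, p (1, q) x = f q := by
    intro q
    rw [← hfx, Finsupp.sum, map_sum]
    by_cases hq : q ∈ f.support
    · rw [Finset.sum_eq_single q, p₁ _ _ (hf q)]
      · intro b _ hb
        exact p₂ _ _ (by simpa using hb.symm) _ (hf b)
      · exact fun h => absurd hq h
    · rw [Finsupp.notMem_support_iff.1 hq]
      refine Finset.sum_eq_zero fun b hb => ?_
      have : q ≠ b := by rintro rfl; exact hq hb
      exact p₂ _ _ (by simpa using this) _ (hf b)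
  have hmem : ∀ q, f q ∈ homOneSub X := by
    intro q
    refine mem_homOneSub_of_gr (hf q) fun g => ?_
    rw [← hp q]
    have := LinearMap.congr_fun (hcomm g q) x
    simp only [LinearMap.comp_apply] at this
    rw [this, act_eq_of_mem_homOneSub hx]
  have : (⟨x, hx⟩ : homOneSub X) = ∑ q ∈ f.support, ⟨f q, hmem q⟩ := by
    apply Subtype.ext
    rw [AddSubmonoidClass.coe_finsetSum]
    exact hfx.symm
  rw [this]
  exact Submodule.sum_mem _ fun q _ => Submodule.mem_iSup_of_mem q (hf q)

/-- The object `Hom_{Z(G)}(1, X)` of `Z(Q)`: the subspace of invariants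
`(⨁_{q} X_{(e,q)})^{G × {e}}` with the induced `Q`-grading and `Q`-action. -/
noncomputable def homOneObj (X : ZCat k (G × Q)) : ZCat k Q where
  carrier := homOneSub X
  gr q := (X.gr (1, q)).comap (homOneSub X).subtype
  act :=
    { toFun := fun q => (X.act (1, q)).restrict (p := homOneSub X) (q := homOneSub X) (by
        intro x hx
        refine ⟨?_, ?_⟩
        · have : (⨆ q : Q, X.gr (1, q)) ≤ (⨆ q : Q, X.gr (1, q)).comap (X.act (1, q)) := by
            refine iSup_le fun r y hy => ?_
            refine Submodule.mem_iSup_of_mem (q * r * q⁻¹) ?_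
            have := X.act_mem (1, q) (1, r) y hy
            simpa using this
          exact this hx.1
        · refine (Representation.mem_invariants _ _).2 fun g => ?_
          change X.act (g, 1) (X.act (1, q) x) = X.act (1, q) x
          rw [← Module.End.mul_apply, ← map_mul]
          have : ((g, 1) * (1, q) : G × Q) = (1, q) * (g, 1) := by ext <;> simp
          rw [this, map_mul, Module.End.mul_apply, act_eq_of_mem_homOneSub hx])
      map_one' := by
        ext x
        change X.act 1 (x : X) = x
        simp
      map_mul' := fun q r => by
        ext x
        change X.act (1, q * r) (x : X) = X.act (1, q) (X.act (1, r) x)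
        rw [← Module.End.mul_apply, ← map_mul]
        simp }
  indep := by
    obtain ⟨p, p₁, p₂, p₃⟩ := exists_proj X.indep X.iSup_eq_top
    rw [iSupIndep_def]
    intro q
    rw [Submodule.disjoint_def]
    intro x hx hx'
    have hle : (⨆ (r : Q) (_ : r ≠ q), (X.gr (1, r)).comap (homOneSub X).subtype) ≤
        (LinearMap.ker (p (1, q))).comap (homOneSub X).subtype := by
      refine iSup₂_le fun r hr y hy => ?_
      exact p₂ (1, q) (1, r) (by simpa using hr.symm) _ hy
    apply Subtype.ext
    rw [← p₁ (1, q) (x : X) hx]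
    exact hle hx'
  iSup_eq_top := iSup_homOneSub X
  act_mem f g x hx := by
    have := X.act_mem (1, f) (1, g) (x : X) hx
    change X.act (1, f) (x : X) ∈ X.gr (1, f * g * f⁻¹)
    simpa using this

variable (k G Q) in
/-- The functor `Hom_{Z(G)}(1, -) : Z(G × Q) ⥤ Z(Q)`, sending `X` to the subspace of
invariants `(⨁_{q} X_{(e,q)})^{G × {e}}`. It is right adjoint to `1 ⊠ -`. -/
noncomputable def homOne : ZCat k (G × Q) ⥤ ZCat k Q where
  obj X := homOneObj X
  map {X Y} f :=
    { lin := f.lin.restrict (p := homOneSub X) (q := homOneSub Y) (by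
        intro x hx
        refine ⟨?_, ?_⟩
        · have : (⨆ q : Q, X.gr (1, q)) ≤ (⨆ q : Q, Y.gr (1, q)).comap f.lin :=
            iSup_le fun r y hy => Submodule.mem_iSup_of_mem r (f.map_gr _ y hy)
          exact this hx.1
        · refine (Representation.mem_invariants _ _).2 fun g => ?_
          change Y.act (g, 1) (f.lin x) = f.lin x
          rw [← f.map_act, act_eq_of_mem_homOneSub hx])
      map_gr := fun q (x : homOneSub X) hx => f.map_gr (1, q) x.1 hx
      map_act := fun q (x : homOneSub X) => Subtype.ext (f.map_act (1, q) x.1) }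
  map_id _ := rfl
  map_comp _ _ := rfl

/-- Morphisms `1 ⊠ Y ⟶ X` correspond to morphisms `Y ⟶ Hom_{Z(G)}(1, X)`. -/
noncomputable def oneBoxHomEquiv (Y : ZCat k Q) (X : ZCat k (G × Q)) :
    ((oneBox k G Q).obj Y ⟶ X) ≃ (Y ⟶ (homOne k G Q).obj X) where
  toFun φ :=
    { lin := (φ.lin ∘ₗ TensorProduct.mk k k Y 1).codRestrict (homOneSub X) (by
        have hle : ⨆ q, Y.gr q ≤ (homOneSub X).comap (φ.lin ∘ₗ TensorProduct.mk k k Y 1) := by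
          refine iSup_le fun q y hy => ?_
          refine mem_homOneSub_of_gr (q := q) ?_ fun g => ?_
          · exact φ.map_gr (1, q) _ (tmul_mem_box (X := unitObj k G)
              (mem_unitObj_one (k := k) 1) hy)
          · refine (φ.map_act (g, 1) ((1 : k) ⊗ₜ[k] y)).symm.trans ?_
            change φ.lin ((1 : k) ⊗ₜ[k] Y.act 1 y) = φ.lin ((1 : k) ⊗ₜ[k] y)
            rw [map_one, Module.End.one_apply]
        exact fun y => hle (Y.iSup_eq_top ▸ Submodule.mem_top))
      map_gr := fun q y hy => φ.map_gr (1, q) _ (tmul_mem_box (X := unitObj k G)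
        (mem_unitObj_one (k := k) 1) hy)
      map_act := fun q y => Subtype.ext (φ.map_act (1, q) ((1 : k) ⊗ₜ[k] y)) }
  invFun ψ :=
    { lin := (homOneSub X).subtype ∘ₗ ψ.lin ∘ₗ (TensorProduct.lid k Y).toLinearMap
      map_gr := fun c => by
        have : (box (unitObj k G) Y).gr c ≤ (X.gr c).comap
            ((homOneSub X).subtype ∘ₗ ψ.lin ∘ₗ (TensorProduct.lid k Y).toLinearMap) := by
          refine box_gr_le fun (r : k) hr y hy => ?_
          change (homOneSub X).subtype (ψ.lin (r • y)) ∈ X.gr c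
          rcases eq_zero_or_of_mem_unitObj (k := k) hr with h | rfl
          · have h1 : c = (1, c.2) := Prod.ext h rfl
            rw [h1]
            exact ψ.map_gr c.2 (r • y) (Submodule.smul_mem _ _ hy)
          · rw [zero_smul, map_zero]
            exact Submodule.zero_mem (X.gr c)
        exact fun x hx => this hx
      map_act := fun c => by
        have : ((homOneSub X).subtype ∘ₗ ψ.lin ∘ₗ (TensorProduct.lid k Y).toLinearMap) ∘ₗ
            (box (unitObj k G) Y).act c = X.act c ∘ₗ
              ((homOneSub X).subtype ∘ₗ ψ.lin ∘ₗ (TensorProduct.lid k Y).toLinearMap) := by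
          refine one_tensor_ext fun y => ?_
          change (homOneSub X).subtype (ψ.lin ((1 : k) • Y.act c.2 y)) =
            X.act c ((homOneSub X).subtype (ψ.lin ((1 : k) • y)))
          rw [one_smul, one_smul, ψ.map_act]
          have hc : c = (1, c.2) * (c.1, 1) := by ext <;> simp
          conv_rhs => rw [hc, map_mul, Module.End.mul_apply]
          have := act_eq_of_mem_homOneSub (ψ.lin y).2 c.1
          erw [this]
          rfl
        exact fun x => LinearMap.congr_fun this x }
  left_inv φ := hom_ext (one_tensor_ext fun y => by
    change φ.lin ((1 : k) ⊗ₜ[k] ((1 : k) • y)) = φ.lin ((1 : k) ⊗ₜ[k] y)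
    rw [one_smul])
  right_inv ψ := hom_ext (LinearMap.ext fun y => Subtype.ext (by
    change ((homOneSub X).subtype (ψ.lin ((1 : k) • y))) = (homOneSub X).subtype (ψ.lin y)
    rw [one_smul]))

variable (k G Q) in
/-- The adjunction between `1 ⊠ -` and `Hom_{Z(G)}(1, -)`. -/
noncomputable def oneBoxAdj : oneBox k G Q ⊣ homOne k G Q :=
  Adjunction.mkOfHomEquiv
    { homEquiv := oneBoxHomEquiv
      homEquiv_naturality_left_symm := fun f g => hom_ext (one_tensor_ext fun y => by
        change (homOneSub _).subtype (g.lin (f.lin ((1 : k) • y))) =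
          (homOneSub _).subtype (g.lin ((1 : k) • f.lin y))
        rw [one_smul, one_smul])
      homEquiv_naturality_right := fun _ _ => rfl }

variable [Finite G] [Finite Q]

/-- `Hom_{Z(G)}(1, -)` is lax monoidal, being right adjoint to the monoidal functor `1 ⊠ -`. -/
noncomputable instance : (homOne k G Q).LaxMonoidal :=
  (oneBoxAdj k G Q).rightAdjointLaxMonoidal

/-- The parent `Hom_{Z(G)}(1, A)` in `Z(Q)` of an algebra `A` in `Z(G × Q) ≃ Z(G) ⊠ Z(Q)`. -/
noncomputable def parent (A : Mon (ZCat k (G × Q))) : Mon (ZCat k Q) :=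
  (homOne k G Q).mapMon.obj A

end Invariants
end ZCat

section Cocycles

/-- A normalised 2-cocycle of a group `S` with values in `kˣ`. -/
structure IsNormCocycle {k S : Type*} [Field k] [Group S] (γ : S → S → kˣ) : Prop where
  one_left : ∀ g, γ 1 g = 1
  one_right : ∀ f, γ f 1 = 1
  cocycle : ∀ f g h, γ f g * γ (f * g) h = γ g h * γ f (g * h)

/-- The symbol `γ(x|y) = γ(x, y) γ(x y x⁻¹, x)⁻¹`, that is the scalar in
`e_x e_y e_x⁻¹ = γ(x|y) e_{x y x⁻¹}`; for commuting `x` and `y` it is `γ(x, y) γ(y, x)⁻¹`. -/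
def cocycleSymbol {k S : Type*} [Field k] [Group S] (γ : S → S → kˣ) (x y : S) : kˣ :=
  γ x y * (γ (x * y * x⁻¹) x)⁻¹

variable {k S : Type*} [Field k] [Group S] {γ : S → S → kˣ}

theorem cocycleSymbol_mul_left (hγ : IsNormCocycle γ) (g h f : S) :
    cocycleSymbol γ (g * h) f =
      cocycleSymbol γ g (h * f * h⁻¹) * cocycleSymbol γ h f := by
  unfold cocycleSymbol
  set f' := h * f * h⁻¹ with hf'
  set f'' := g * f' * g⁻¹ with hf''
  have e0 : g * h * f * (g * h)⁻¹ = f'' := by rw [hf'', hf']; group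
  have e1 : f'' * g = g * f' := by rw [hf'']; group
  have e2 : f' * h = h * f := by rw [hf']; group
  have h1 := hγ.cocycle g h f
  have h2 := hγ.cocycle f'' g h
  have h3 := hγ.cocycle g f' h
  rw [e1] at h2
  rw [e2] at h3
  rw [e0]
  have h1' : γ (g * h) f = (γ g h)⁻¹ * (γ h f * γ g (h * f)) := by rw [← h1]; group
  have h2' : γ f'' (g * h) = (γ g h)⁻¹ * (γ f'' g * γ (g * f') h) := by rw [h2]; group
  have h3' : γ g (h * f) = (γ f' h)⁻¹ * (γ g f' * γ (g * f') h) := by rw [h3]; group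
  rw [h1', h2', h3']
  apply Units.ext
  push_cast
  field_simp

theorem cocycleSymbol_mul_right (hγ : IsNormCocycle γ) (h f g : S) :
    γ f g * cocycleSymbol γ h (f * g) = cocycleSymbol γ h f * cocycleSymbol γ h g *
      γ (h * f * h⁻¹) (h * g * h⁻¹) := by
  unfold cocycleSymbol
  set f' := h * f * h⁻¹ with hf'
  set g' := h * g * h⁻¹ with hg'
  have e0 : h * (f * g) * h⁻¹ = f' * g' := by rw [hf', hg']; group
  have e1 : f' * h = h * f := by rw [hf']; group
  have e2 : g' * h = h * g := by rw [hg']; group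
  have h1 := hγ.cocycle h f g
  have h2 := hγ.cocycle f' g' h
  have h3 := hγ.cocycle f' h g
  rw [e2] at h2
  rw [e1] at h3
  rw [e0]
  have h1' : γ h (f * g) = (γ f g)⁻¹ * (γ h f * γ (h * f) g) := by rw [h1]; group
  have h2' : γ (f' * g') h = (γ f' g')⁻¹ * (γ g' h * γ f' (h * g)) := by rw [← h2]; group
  have h3' : γ (h * f) g = (γ f' h)⁻¹ * (γ h g * γ f' (h * g)) := by rw [← h3]; group
  rw [h1', h2', h3']
  apply Units.ext
  push_cast
  field_simp

theorem cocycleSymbol_of_comm {x y : S} (h : x * y = y * x) :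
    cocycleSymbol γ x y = γ x y * (γ y x)⁻¹ := by
  unfold cocycleSymbol
  rw [h, mul_inv_cancel_right]

end Cocycles

/-- The data `(H, F, γ, ε)`: a subgroup `H` of `G`, a normal subgroup `F` of `H`, a normalised
2-cocycle `γ` of `F` and a function `ε : H × F → kˣ` compatible with it. -/
structure AlgDatum (k G : Type u) [Field k] [Group G] where
  H : Subgroup G
  F : Subgroup G
  le : F ≤ H
  conj_mem : ∀ h ∈ H, ∀ f ∈ F, h * f * h⁻¹ ∈ F
  γ : F → F → kˣ
  isCocycle : IsNormCocycle γ
  /-- `ε h f` is `ε_h(f)` -/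
  ε : H → F → kˣ
  eps_mul : ∀ (g h : H) (f : F),
    ε (g * h) f = ε g ⟨h * f * (h : G)⁻¹, conj_mem h h.2 f f.2⟩ * ε h f
  eps_coboundary : ∀ (h : H) (f g : F), γ f g * ε h (f * g) = ε h f * ε h g *
    γ ⟨h * f * (h : G)⁻¹, conj_mem h h.2 f f.2⟩ ⟨h * g * (h : G)⁻¹, conj_mem h h.2 g g.2⟩
  eps_comm : ∀ f g : F, γ f g = ε ⟨f, le f.2⟩ g * γ (f * g * f⁻¹) f

namespace AlgDatum

section Pair

variable {k G : Type u} [Field k] [Group G]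

/-- The datum `(U, U, γ, ε)` defined by a subgroup `U` and a normalised 2-cocycle `γ` of `U`;
here `ε_u(v) = γ(u|v)` is the only possibility. -/
def ofPair (U : Subgroup G) (γ : U → U → kˣ) (hγ : IsNormCocycle γ) : AlgDatum k G where
  H := U
  F := U
  le := le_rfl
  conj_mem h hh f hf := U.mul_mem (U.mul_mem hh hf) (U.inv_mem hh)
  γ := γ
  isCocycle := hγ
  ε := cocycleSymbol γ
  eps_mul g h f := cocycleSymbol_mul_left hγ g h f
  eps_coboundary h f g := cocycleSymbol_mul_right hγ h f g
  eps_comm f g := by simp [cocycleSymbol]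

end Pair

section Algebra

variable {k G : Type u} [Field k] [Group G] (D : AlgDatum k G)

/-- `h f h⁻¹` as an element of `F`. -/
def conj (h : D.H) (f : D.F) : D.F := ⟨h * f * (h : G)⁻¹, D.conj_mem h h.2 f f.2⟩

theorem conj_mul (h : D.H) (f f' : D.F) : D.conj h (f * f') = D.conj h f * D.conj h f' := by
  apply Subtype.ext
  simp [conj, mul_assoc]

theorem conj_conj (g h : D.H) (f : D.F) : D.conj g (D.conj h f) = D.conj (g * h) f := by
  apply Subtype.ext
  simp [conj, mul_assoc]

theorem conj_one (h : D.H) : D.conj h 1 = 1 := by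
  apply Subtype.ext
  simp [conj]

theorem one_conj (f : D.F) : D.conj 1 f = f := by
  apply Subtype.ext
  simp [conj]

theorem ε_mul (g h : D.H) (f : D.F) : D.ε (g * h) f = D.ε g (D.conj h f) * D.ε h f :=
  D.eps_mul g h f

theorem ε_one (f : D.F) : D.ε 1 f = 1 := by
  have := D.ε_mul 1 1 f
  rw [one_mul, one_conj] at this
  exact left_eq_mul.1 this

theorem γ_mul_ε (h : D.H) (f g : D.F) :
    D.γ f g * D.ε h (f * g) = D.ε h f * D.ε h g * D.γ (D.conj h f) (D.conj h g) :=
  D.eps_coboundary h f g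

theorem ε_apply_one (h : D.H) : D.ε h 1 = 1 := by
  have := D.γ_mul_ε h 1 1
  rw [conj_one, D.isCocycle.one_left, one_mul, one_mul, mul_one] at this
  exact left_eq_mul.1 this

/-- The relations `a_{gh,f} = ε_h(f) a_{g, h f h⁻¹}`. -/
noncomputable def rel : Submodule k (G × D.F →₀ k) :=
  Submodule.span k (Set.range fun t : G × D.H × D.F =>
    Finsupp.single (t.1 * t.2.1, t.2.2) 1 -
      (D.ε t.2.1 t.2.2 : k) • Finsupp.single (t.1, D.conj t.2.1 t.2.2) 1)

/-- The vector space spanned by the symbols `a_{g,f}`, `g ∈ G`, `f ∈ F`, modulo the relations. -/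
abbrev Carrier : Type u := (G × D.F →₀ k) ⧸ D.rel

/-- The generator `a_{g,f}`. -/
noncomputable def a (g : G) (f : D.F) : D.Carrier := D.rel.mkQ (Finsupp.single (g, f) 1)

theorem a_mul (g : G) (h : D.H) (f : D.F) :
    D.a (g * h) f = (D.ε h f : k) • D.a g (D.conj h f) := by
  unfold a
  rw [← map_smul, ← sub_eq_zero, ← map_sub, Submodule.mkQ_apply, Submodule.Quotient.mk_eq_zero]
  exact Submodule.subset_span ⟨(g, h, f), rfl⟩

section Lift

variable {W : Type*} [AddCommGroup W] [Module k W]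

theorem rel_le_ker (φ : G → D.F → W)
    (h : ∀ g h f, φ (g * (h : D.H)) f = (D.ε h f : k) • φ g (D.conj h f)) :
    D.rel ≤ LinearMap.ker (Finsupp.linearCombination k fun p : G × D.F => φ p.1 p.2) := by
  refine Submodule.span_le.2 ?_
  rintro _ ⟨t, rfl⟩
  simp [h]

/-- A linear map out of the algebra, defined on generators. -/
noncomputable def lift (φ : G → D.F → W)
    (h : ∀ g h f, φ (g * (h : D.H)) f = (D.ε h f : k) • φ g (D.conj h f)) : D.Carrier →ₗ[k] W :=
  D.rel.liftQ (Finsupp.linearCombination k fun p : G × D.F => φ p.1 p.2) (D.rel_le_ker φ h)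

@[simp] theorem lift_a (φ : G → D.F → W) (h) (g : G) (f : D.F) :
    D.lift φ h (D.a g f) = φ g f := by
  rw [lift, a, Submodule.mkQ_apply, Submodule.liftQ_apply, Finsupp.linearCombination_single,
    one_smul]

variable {D} in
theorem lin_ext {φ ψ : D.Carrier →ₗ[k] W} (h : ∀ g f, φ (D.a g f) = ψ (D.a g f)) : φ = ψ := by
  refine Submodule.linearMap_qext _ (Finsupp.lhom_ext fun p c => ?_)
  have := h p.1 p.2
  simp only [a] at this
  have hc : Finsupp.single p c = c • Finsupp.single p (1 : k) := by simp
  rw [hc, map_smul, map_smul]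
  exact congrArg (c • ·) this

end Lift

/-- The linear map `a_{g,f} ↦ a_{g'g,f}`. -/
noncomputable def actLin (g' : G) : D.Carrier →ₗ[k] D.Carrier :=
  D.lift (fun g f => D.a (g' * g) f) fun g h f => by rw [← mul_assoc, a_mul]

theorem actLin_a (g' g : G) (f : D.F) : D.actLin g' (D.a g f) = D.a (g' * g) f := by
  rw [actLin, lift_a]

/-- The `G`-action `g'(a_{g,f}) = a_{g'g,f}`. -/
noncomputable def act : Representation k G D.Carrier where
  toFun := D.actLin
  map_one' := lin_ext fun g f => by rw [actLin_a, one_mul, Module.End.one_apply]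
  map_mul' g g' := lin_ext fun x f => by
    rw [Module.End.mul_apply, actLin_a, actLin_a, actLin_a, mul_assoc]

@[simp] theorem act_a (g' g : G) (f : D.F) : D.act g' (D.a g f) = D.a (g' * g) f :=
  D.actLin_a g' g f

/-- The `G`-grading `|a_{g,f}| = g f g⁻¹`. -/
noncomputable def gr (x : G) : Submodule k D.Carrier :=
  Submodule.span k {y | ∃ (g : G) (f : D.F), g * (f : G) * g⁻¹ = x ∧ D.a g f = y}

theorem a_mem_gr (g : G) (f : D.F) : D.a g f ∈ D.gr (g * f * g⁻¹) :=
  Submodule.subset_span ⟨g, f, rfl, rfl⟩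

variable {D} in
theorem gr_le {x : G} {S : Submodule k D.Carrier}
    (h : ∀ (g : G) (f : D.F), g * (f : G) * g⁻¹ = x → D.a g f ∈ S) : D.gr x ≤ S := by
  refine Submodule.span_le.2 ?_
  rintro _ ⟨g, f, hgf, rfl⟩
  exact h g f hgf

open Classical in
/-- The projection onto the homogeneous component of degree `x`. -/
noncomputable def projGr (x : G) : D.Carrier →ₗ[k] D.Carrier :=
  D.lift (fun g f => if g * (f : G) * g⁻¹ = x then D.a g f else 0) (by
    intro g h f
    have : g * (D.conj h f : G) * g⁻¹ = g * h * f * (g * h)⁻¹ := by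
      simp [conj, mul_assoc]
    rw [this]
    split_ifs
    · exact D.a_mul g h f
    · simp)

theorem iSupIndep_gr : iSupIndep D.gr := by
  classical
  refine iSupIndep_of_proj _ D.projGr ?_ ?_
  · intro x y hy
    have : D.gr x ≤ LinearMap.eqLocus (D.projGr x) LinearMap.id := gr_le fun g f hgf => by
      rw [LinearMap.mem_eqLocus, projGr, lift_a, if_pos hgf]; rfl
    exact this hy
  · intro x y hxy z hz
    have : D.gr y ≤ LinearMap.ker (D.projGr x) := gr_le fun g f hgf => by
      rw [LinearMap.mem_ker, projGr, lift_a, if_neg fun h => hxy (h.symm.trans hgf)]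
    exact this hz

/-- The object of `Z(G)` underlying the algebra `A(H, F, γ, ε)`. -/
noncomputable def obj [Finite G] : ZCat k G where
  carrier := D.Carrier
  gr := D.gr
  act := D.act
  indep := D.iSupIndep_gr
  iSup_eq_top := by
    rw [eq_top_iff]
    have : LinearMap.ker (iSup D.gr).mkQ = ⊤ := by
      rw [LinearMap.ker_eq_top]
      refine lin_ext fun g f => ?_
      rw [LinearMap.zero_apply, Submodule.mkQ_apply, Submodule.Quotient.mk_eq_zero]
      exact Submodule.mem_iSup_of_mem _ (D.a_mem_gr g f)
    rw [Submodule.ker_mkQ] at this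
    rw [this]
  act_mem f g x hx := by
    have : D.gr g ≤ (D.gr (f * g * f⁻¹)).comap (D.act f) := by
      refine gr_le fun x y hxy => ?_
      rw [Submodule.mem_comap, act_a, ← hxy]
      have : f * (x * (y : G) * x⁻¹) * f⁻¹ = (f * x) * y * (f * x)⁻¹ := by group
      rw [this]
      exact D.a_mem_gr _ _
    exact this hx

open Classical in
/-- The product of two generators: `a_{g,f} a_{g,f'} = γ(f,f') a_{g,ff'}`, extended to
`a_{gh,f'} = ε_h(f') a_{g,h f' h⁻¹}` for `h ∈ H`, and zero if `g H ≠ g' H`. -/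
noncomputable def mulGen (g : G) (f : D.F) (g' : G) (f' : D.F) : D.Carrier :=
  if h : g⁻¹ * g' ∈ D.H then
    ((D.γ f (D.conj ⟨_, h⟩ f') * D.ε ⟨_, h⟩ f' : kˣ) : k) • D.a g (f * D.conj ⟨_, h⟩ f')
  else 0

theorem mulGen_mul (g : G) (f : D.F) (h : D.H) (f' : D.F) :
    D.mulGen g f (g * h) f' =
      ((D.γ f (D.conj h f') * D.ε h f' : kˣ) : k) • D.a g (f * D.conj h f') := by
  have hm : g⁻¹ * (g * h) = (h : G) := by group
  have hm' : g⁻¹ * (g * h) ∈ D.H := by rw [hm]; exact h.2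
  rw [mulGen, dif_pos hm']
  have : (⟨g⁻¹ * (g * h), hm'⟩ : D.H) = h := Subtype.ext hm
  rw [this]

theorem mulGen_of_notMem {g g' : G} (h : g⁻¹ * g' ∉ D.H) (f f' : D.F) :
    D.mulGen g f g' f' = 0 := dif_neg h

theorem mulGen_right (g : G) (f : D.F) (g' : G) (h : D.H) (f' : D.F) :
    D.mulGen g f (g' * h) f' = (D.ε h f' : k) • D.mulGen g f g' (D.conj h f') := by
  by_cases hm : g⁻¹ * g' ∈ D.H
  · obtain ⟨h', rfl⟩ : ∃ h' : D.H, g' = g * h' :=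
      ⟨⟨_, hm⟩, (mul_inv_cancel_left g g').symm⟩
    have : g * (h' : G) * h = g * ((h' * h : D.H) : G) := by simp [mul_assoc]
    rw [this, mulGen_mul, mulGen_mul, conj_conj, ε_mul, smul_smul]
    congr 1
    push_cast
    ring
  · have : g⁻¹ * (g' * h) ∉ D.H := by
      rwa [← mul_assoc, D.H.mul_mem_cancel_right h.2]
    rw [mulGen_of_notMem _ hm, mulGen_of_notMem _ this, smul_zero]

theorem mulGen_left (g : G) (h : D.H) (f : D.F) (g' : G) (f' : D.F) :
    D.mulGen (g * h) f g' f' = (D.ε h f : k) • D.mulGen g (D.conj h f) g' f' := by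
  by_cases hm : (g * h)⁻¹ * g' ∈ D.H
  · obtain ⟨h', rfl⟩ : ∃ h' : D.H, g' = g * h * h' := ⟨⟨_, hm⟩, by simp [mul_assoc]⟩
    have : g * (h : G) * h' = g * ((h * h' : D.H) : G) := by simp [mul_assoc]
    rw [mulGen_mul, this, mulGen_mul, a_mul, conj_mul, conj_conj, ε_mul, smul_smul, smul_smul]
    congr 1
    have := congrArg (fun u : kˣ => (u : k)) (D.γ_mul_ε h f (D.conj h' f'))
    rw [conj_conj] at this
    push_cast at this ⊢
    linear_combination (D.ε h' f' : k) * this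
  · have : g⁻¹ * g' ∉ D.H := by
      intro h'
      apply hm
      have := D.H.mul_mem (D.H.inv_mem h.2) h'
      rwa [← mul_assoc, ← mul_inv_rev] at this
    rw [mulGen_of_notMem _ hm, mulGen_of_notMem _ this, smul_zero]

/-- The multiplication of `A(H, F, γ, ε)`. -/
noncomputable def mul : D.Carrier →ₗ[k] D.Carrier →ₗ[k] D.Carrier :=
  D.lift (fun g f => D.lift (fun g' f' => D.mulGen g f g' f') (D.mulGen_right g f))
    fun g h f => lin_ext fun g' f' => by simp [mulGen_left]

theorem mul_a (g : G) (f : D.F) (g' : G) (f' : D.F) :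
    D.mul (D.a g f) (D.a g' f') = D.mulGen g f g' f' := by
  simp [mul]

theorem mul_a_same (g : G) (f f' : D.F) :
    D.mul (D.a g f) (D.a g f') = (D.γ f f' : k) • D.a g (f * f') := by
  have := D.mulGen_mul g f 1 f'
  rw [one_conj, ε_one, mul_one, OneMemClass.coe_one, mul_one] at this
  rw [mul_a, this]

theorem mul_a_ne {g g' : G} (h : g⁻¹ * g' ∉ D.H) (f f' : D.F) :
    D.mul (D.a g f) (D.a g' f') = 0 := by
  rw [mul_a, mulGen_of_notMem _ h]

theorem exists_a_eq {g g' : G} (h : g⁻¹ * g' ∈ D.H) (f : D.F) :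
    ∃ (c : k) (f' : D.F), D.a g' f = c • D.a g f' := by
  refine ⟨(D.ε ⟨_, h⟩ f : k), D.conj ⟨_, h⟩ f, ?_⟩
  rw [← a_mul]
  simp

theorem mul_assoc_a (x : G) (f : D.F) (y : G) (g : D.F) (z : G) (l : D.F) :
    D.mul (D.mul (D.a x f) (D.a y g)) (D.a z l) =
      D.mul (D.a x f) (D.mul (D.a y g) (D.a z l)) := by
  by_cases hy : x⁻¹ * y ∈ D.H
  · obtain ⟨c, g', hc⟩ := D.exists_a_eq hy g
    rw [hc]
    simp only [map_smul, LinearMap.smul_apply]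
    congr 1
    by_cases hz : x⁻¹ * z ∈ D.H
    · obtain ⟨d, l', hd⟩ := D.exists_a_eq hz l
      rw [hd]
      simp only [map_smul, LinearMap.smul_apply, mul_a_same, smul_smul]
      rw [mul_assoc f]
      congr 1
      have := congrArg (fun u : kˣ => (u : k)) (D.isCocycle.cocycle f g' l')
      push_cast at this
      linear_combination d * this
    · simp [mul_a_same, mul_a_ne _ hz]
  · rw [mul_a_ne _ hy]
    by_cases hz : y⁻¹ * z ∈ D.H
    · obtain ⟨d, l', hd⟩ := D.exists_a_eq hz l
      rw [hd]
      simp [mul_a_same, mul_a_ne _ hy]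
    · simp [mul_a_ne _ hz]

/-- The unit `∑ a_{g,e}`, the sum over the cosets `g H` (note that `a_{gh,e} = a_{g,e}`). -/
noncomputable def one : D.Carrier := ∑ᶠ c : G ⧸ D.H, D.a c.out 1

theorem a_mul_one (g : G) (h : D.H) : D.a (g * h) 1 = D.a g 1 := by
  rw [a_mul, ε_apply_one, conj_one, Units.val_one, one_smul]

theorem a_out_one (g : G) : D.a (g : G ⧸ D.H).out 1 = D.a g 1 := by
  obtain ⟨h, hh⟩ := QuotientGroup.mk_out_eq_mul D.H g
  rw [hh, a_mul_one]

theorem one_mul_a [Finite G] (g : G) (f : D.F) : D.mul D.one (D.a g f) = D.a g f := by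
  classical
  have := Fintype.ofFinite (G ⧸ D.H)
  rw [one, finsum_eq_sum_of_fintype, map_sum, LinearMap.sum_apply,
    Finset.sum_eq_single (g : G ⧸ D.H)]
  · rw [a_out_one, mul_a_same, D.isCocycle.one_left, one_mul, Units.val_one, one_smul]
  · intro c _ hc
    refine D.mul_a_ne (fun h => hc ?_) _ _
    rw [← QuotientGroup.out_eq' c]
    exact QuotientGroup.eq.2 h
  · exact fun h => absurd (Finset.mem_univ _) h

theorem mul_one_a [Finite G] (g : G) (f : D.F) : D.mul (D.a g f) D.one = D.a g f := by
  classical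
  have := Fintype.ofFinite (G ⧸ D.H)
  rw [one, finsum_eq_sum_of_fintype, map_sum, Finset.sum_eq_single (g : G ⧸ D.H)]
  · rw [a_out_one, mul_a_same, D.isCocycle.one_right, mul_one, Units.val_one, one_smul]
  · intro c _ hc
    refine D.mul_a_ne (fun h => hc ?_) _ _
    rw [← QuotientGroup.out_eq' c]
    exact (QuotientGroup.eq.2 h).symm
  · exact fun h => absurd (Finset.mem_univ _) h

theorem act_one [Finite G] (g : G) : D.act g D.one = D.one := by
  have := Fintype.ofFinite (G ⧸ D.H)
  rw [one, finsum_eq_sum_of_fintype, map_sum]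
  refine Fintype.sum_equiv (MulAction.toPerm g) _ _ fun c => ?_
  rw [act_a]
  have : (MulAction.toPerm g c : G ⧸ D.H) = ((g * c.out : G) : G ⧸ D.H) := by
    conv_lhs => rw [← QuotientGroup.out_eq' c]
    rfl
  rw [this, a_out_one]

theorem one_mem [Finite G] : D.one ∈ D.gr 1 := by
  have := Fintype.ofFinite (G ⧸ D.H)
  rw [one, finsum_eq_sum_of_fintype]
  refine Submodule.sum_mem _ fun c _ => ?_
  have := D.a_mem_gr c.out 1
  simpa using this

theorem mul_mem_gr {x y : G} {u v : D.Carrier} (hu : u ∈ D.gr x) (hv : v ∈ D.gr y) :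
    D.mul u v ∈ D.gr (x * y) := by
  have h1 : D.gr x ≤ (D.gr (x * y)).comap (D.mul.flip v) := by
    refine gr_le fun g f hgf => ?_
    have h2 : D.gr y ≤ (D.gr (x * y)).comap (D.mul (D.a g f)) := by
      refine gr_le fun g' f' hgf' => ?_
      rw [Submodule.mem_comap]
      by_cases h : g⁻¹ * g' ∈ D.H
      · obtain ⟨h', rfl⟩ : ∃ h' : D.H, g' = g * h' := ⟨⟨_, h⟩, by simp⟩
        rw [a_mul, map_smul, mul_a_same]
        refine Submodule.smul_mem _ _ (Submodule.smul_mem _ _ ?_)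
        have := D.a_mem_gr g (f * D.conj h' f')
        have he : g * ((f * D.conj h' f' : D.F) : G) * g⁻¹ = x * y := by
          rw [← hgf, ← hgf']
          simp [conj, mul_assoc]
        rwa [he] at this
      · rw [mul_a_ne _ h]
        exact Submodule.zero_mem _
    exact h2 hv
  exact h1 hu

theorem mul_act (g : G) (u v : D.Carrier) :
    D.mul (D.act g u) (D.act g v) = D.act g (D.mul u v) := by
  have : (D.mul.compl₁₂ (D.act g) (D.act g)) = D.mul.compr₂ (D.act g) := by
    refine lin_ext fun x f => lin_ext fun y f' => ?_
    simp only [LinearMap.compl₁₂_apply, LinearMap.compr₂_apply, act_a]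
    by_cases h : x⁻¹ * y ∈ D.H
    · obtain ⟨h', rfl⟩ : ∃ h' : D.H, y = x * h' := ⟨⟨_, h⟩, by simp⟩
      rw [← mul_assoc, a_mul, a_mul]
      simp only [map_smul, mul_a_same, act_a]
    · have h2 : (g * x)⁻¹ * (g * y) ∉ D.H := by
        have : (g * x)⁻¹ * (g * y) = x⁻¹ * y := by group
        rwa [this]
      rw [mul_a_ne _ h, mul_a_ne _ h2, map_zero]
  exact LinearMap.congr_fun (LinearMap.congr_fun this u) v

variable [Finite G]

/-- The algebra `A(H, F, γ, ε)` in the category `Z(G)`. -/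
noncomputable def alg : Mon (ZCat k G) where
  X := D.obj
  mon :=
    { one :=
        { lin := LinearMap.toSpanSingleton k D.Carrier D.one
          map_gr := fun g (r : k) hr => by
            change r • D.one ∈ D.gr g
            rcases ZCat.eq_zero_or_of_mem_unitObj (k := k) hr with rfl | rfl
            · exact Submodule.smul_mem _ _ D.one_mem
            · rw [zero_smul]
              exact Submodule.zero_mem _
          map_act := fun g (r : k) => by
            change r • D.one = D.act g (r • D.one)
            rw [map_smul, act_one] }
      mul := ZCat.homOfTensor (X := D.obj) (Y := D.obj) (Z := D.obj) (TensorProduct.lift D.mul)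
        (fun _ _ _ hx _ hy => D.mul_mem_gr hx hy) (fun g x y => D.mul_act g x y)
      one_mul := ZCat.hom_ext (TensorProduct.ext (LinearMap.ext_ring (lin_ext fun g f => by
        change D.mul ((1 : k) • D.one) (D.a g f) = (1 : k) • D.a g f
        rw [one_smul, one_smul, one_mul_a])))
      mul_one := ZCat.hom_ext (TensorProduct.ext (lin_ext fun g f => LinearMap.ext_ring (by
        change D.mul (D.a g f) ((1 : k) • D.one) = (1 : k) • D.a g f
        rw [one_smul, one_smul, mul_one_a])))
      mul_assoc := ZCat.hom_ext (TensorProduct.ext (TensorProduct.ext (lin_ext fun x f =>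
        lin_ext fun y g => lin_ext fun z l => D.mul_assoc_a x f y g z l))) }

end Algebra

end AlgDatum

section Kernel

variable {k G Q : Type u} [Field k] [Group G] [Group Q]

theorem mul_comm_of_factors {U : Subgroup (G × Q)}
    (v : (U ⊓ Subgroup.prod ⊥ ⊤ : Subgroup (G × Q)))
    (u : (U ⊓ Subgroup.prod ⊤ ⊥ : Subgroup (G × Q))) :
    (⟨v.1, v.2.1⟩ : U) * ⟨u.1, u.2.1⟩ = ⟨u.1, u.2.1⟩ * ⟨v.1, v.2.1⟩ := by
  have h1 : v.1.1 = 1 := v.2.2.1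
  have h2 : u.1.2 = 1 := u.2.2.2
  ext <;> simp [h1, h2]

/-- The homomorphism `U ∩ ({e} × Q) → Hom(U ∩ (G × {e}), kˣ)` sending `v` to the character
`γ_v : u ↦ γ(v, u) γ(u, v)⁻¹`. -/
def gammaBar (U : Subgroup (G × Q)) (γ : U → U → kˣ) (hγ : IsNormCocycle γ) :
    (U ⊓ Subgroup.prod ⊥ ⊤ : Subgroup (G × Q)) →*
      ((U ⊓ Subgroup.prod ⊤ ⊥ : Subgroup (G × Q)) →* kˣ) where
  toFun := fun v =>
    { toFun := fun u => γ ⟨v.1, v.2.1⟩ ⟨u.1, u.2.1⟩ * (γ ⟨u.1, u.2.1⟩ ⟨v.1, v.2.1⟩)⁻¹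
      map_one' := by
        have h1 := hγ.one_left ⟨v.1, v.2.1⟩
        have h2 := hγ.one_right ⟨v.1, v.2.1⟩
        change γ ⟨v.1, v.2.1⟩ 1 * (γ 1 ⟨v.1, v.2.1⟩)⁻¹ = 1
        rw [h1, h2, inv_one, mul_one]
      map_mul' := fun u w => by
        have h := cocycleSymbol_mul_right hγ ⟨v.1, v.2.1⟩ ⟨u.1, u.2.1⟩ ⟨w.1, w.2.1⟩
        have h3 := mul_comm_of_factors v (u * w)
        rw [mul_comm_of_factors v u, mul_comm_of_factors v w, mul_inv_cancel_right, mul_inv_cancel_right,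
          mul_comm, mul_left_inj, cocycleSymbol_of_comm (mul_comm_of_factors v u),
          cocycleSymbol_of_comm (mul_comm_of_factors v w)] at h
        rw [← h]
        exact (cocycleSymbol_of_comm h3).symm }
  map_one' := by
    ext u
    have h1 := hγ.one_left ⟨u.1, u.2.1⟩
    have h2 := hγ.one_right ⟨u.1, u.2.1⟩
    change ((γ 1 ⟨u.1, u.2.1⟩ * (γ ⟨u.1, u.2.1⟩ 1)⁻¹ : kˣ) : k) = _
    rw [h1, h2, inv_one, mul_one]
    rfl
  map_mul' := fun v w => MonoidHom.ext fun u => by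
    have h := cocycleSymbol_mul_left hγ ⟨v.1, v.2.1⟩ ⟨w.1, w.2.1⟩ ⟨u.1, u.2.1⟩
    have h3 := mul_comm_of_factors (v * w) u
    rw [mul_comm_of_factors w u, mul_inv_cancel_right, cocycleSymbol_of_comm (mul_comm_of_factors v u),
      cocycleSymbol_of_comm (mul_comm_of_factors w u)] at h
    exact (cocycleSymbol_of_comm h3).symm.trans h

/-- The kernel of `gammaBar`, viewed as a subgroup of `Q`. -/
def kernelK (U : Subgroup (G × Q)) (γ : U → U → kˣ) (hγ : IsNormCocycle γ) : Subgroup Q :=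
  (gammaBar U γ hγ).ker.map
    ((MonoidHom.snd G Q).comp (U ⊓ Subgroup.prod ⊥ ⊤ : Subgroup (G × Q)).subtype)

end Kernel

/-! ### The kernel `K`, independence of the choice of lifts, and the datum on `Q`. -/

section KernelDatum

variable {k G Q : Type u} [Field k] [Group G] [Group Q] {U : Subgroup (G × Q)} {γ : U → U → kˣ}
  (hγ : IsNormCocycle γ)

/-! Write N = U ∩ (G × {e}), and a_{x,u} for the generators of A(U, γ). The degree x u x⁻¹ of
a_{x,u} lies in {e} × Q exactly when u = (e, v). An invariant is, up to the factor |G|, its own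
symmetrisation over G, and symmetrising forgets the G-coordinate of x. So the parent is spanned by
the sums S(q, v) = ∑ g, a_{(g,q),(e,v)}.

Each n in N commutes with (e, v), so the defining relation reads a_{xn,(e,v)} = γ(n|v) a_{x,(e,v)}.
Symmetrisation does not distinguish xn from x, whence S(q, v) = γ(n|v) S(q, v). Thus S(q, v) = 0
unless γ(n|v) = 1 for all n in N, that is, unless v lies in K (`symSum_a_eq_zero`). For v in K the
sums satisfy the relations of A(pr₂ U, K, γ|_K, ε): two lifts of q differ by an element of N, whose
symbol with v is trivial, so every lift gives the same scalar (`cocycleSymbol_kernelIncl_congr`).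

There are no further relations. Sending a_{(g,q),(e,v)} to a_{q,v} for v in K, and the other
generators to zero, is well defined on A(U, γ). Composed with a_{q,v} ↦ S(q, v) it gives
multiplication by |G| on A(pr₂ U, K, γ|_K, ε) and on the invariants (`ofInvariants_toInvariants`,
`toInvariants_ofInvariants`), and |G| is invertible in characteristic zero.

Multiplying one term of S(q, v) by S(q, w), only the |N| terms over the same coset of U survive, and
they all contribute equally (`mul_a_symSum_a`). Hence S(q, v) S(q, w) = |N| γ(v, w) S(q, vw), and
|N|⁻¹ S is multiplicative. Preservation of the unit is then automatic. -/

theorem mem_kernelK_iff {v : Q} : v ∈ kernelK U γ hγ ↔ ∃ h : ((1, v) : G × Q) ∈ U,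
    ∀ (n : G) (hn : ((n, 1) : G × Q) ∈ U), cocycleSymbol γ ⟨(n, 1), hn⟩ ⟨(1, v), h⟩ = 1 := by
  -- The symbol γ(n|v) is the inverse of γ̄(v)(n), the two elements being in different factors. Only
  -- triviality matters, and γ(n|v) is the scalar that occurs in the relations of A(U, γ).
  have hc : ∀ (n : G) (hn : ((n, 1) : G × Q) ∈ U) (h : ((1, v) : G × Q) ∈ U),
      cocycleSymbol γ ⟨(n, 1), hn⟩ ⟨(1, v), h⟩ =
        γ ⟨(n, 1), hn⟩ ⟨(1, v), h⟩ * (γ ⟨(1, v), h⟩ ⟨(n, 1), hn⟩)⁻¹ :=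
    fun n hn h => cocycleSymbol_of_comm (by ext <;> simp)
  constructor
  · rintro ⟨⟨⟨g, w⟩, hw⟩, hk, rfl⟩
    obtain rfl : g = 1 := hw.2.1
    refine ⟨hw.1, fun n hn => ?_⟩
    have h1 := DFunLike.congr_fun (MonoidHom.mem_ker.1 hk) ⟨(n, 1), hn, trivial, rfl⟩
    change γ ⟨(1, w), _⟩ ⟨(n, 1), _⟩ * (γ ⟨(n, 1), _⟩ ⟨(1, w), _⟩)⁻¹ = 1 at h1
    refine (hc n hn hw.1).trans ?_
    rw [mul_inv_eq_one] at h1 ⊢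
    exact h1.symm
  · rintro ⟨h, hn⟩
    refine ⟨⟨(1, v), h, rfl, trivial⟩, MonoidHom.mem_ker.2 (MonoidHom.ext ?_), rfl⟩
    rintro ⟨⟨n, q⟩, hu⟩
    obtain rfl : q = 1 := hu.2.2
    change γ ⟨(1, v), _⟩ ⟨(n, 1), _⟩ * (γ ⟨(n, 1), _⟩ ⟨(1, v), _⟩)⁻¹ = 1
    have h1 := hn n hu.1
    rw [hc, mul_inv_eq_one] at h1
    rw [mul_inv_eq_one]
    exact h1.symm

/-- The inclusion `v ↦ (e, v)` of the kernel into `U`. -/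
def kernelIncl : kernelK U γ hγ →* U where
  toFun v := ⟨(1, v), ((mem_kernelK_iff hγ).1 v.2).1⟩
  map_one' := rfl
  map_mul' _ _ := Subtype.ext (Prod.ext (mul_one (1 : G)).symm rfl)

theorem cocycleSymbol_kernelIncl_of_snd_eq_one (n : U) (hn : n.1.2 = 1) (v : kernelK U γ hγ) :
    cocycleSymbol γ n (kernelIncl hγ v) = 1 := by
  obtain ⟨⟨n, q⟩, h⟩ := n
  obtain rfl : q = 1 := hn
  exact ((mem_kernelK_iff hγ).1 v.2).2 n h

theorem conj_kernelIncl_of_snd_eq_one (n : U) (hn : n.1.2 = 1) (v : kernelK U γ hγ) :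
    n * kernelIncl hγ v * n⁻¹ = kernelIncl hγ v :=
  Subtype.ext (Prod.ext (by simp [kernelIncl]) (by simp [kernelIncl, hn]))

/-- Here u' = u n with n = u⁻¹u' in U ∩ (G × {e}). Such n centralises (e, v) and has trivial symbol
with it, so multiplicativity in the left argument gives the claim. This makes ε independent of the
lift, and it also yields normality of K below. -/
theorem cocycleSymbol_kernelIncl_congr {u u' : U} (h : u.1.2 = u'.1.2) (v : kernelK U γ hγ) :
    cocycleSymbol γ u (kernelIncl hγ v) = cocycleSymbol γ u' (kernelIncl hγ v) := by
  have hn : (u⁻¹ * u').1.2 = 1 := by simp [h]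
  have h1 := cocycleSymbol_mul_left hγ u (u⁻¹ * u') (kernelIncl hγ v)
  rw [mul_inv_cancel_left, conj_kernelIncl_of_snd_eq_one hγ _ hn,
    cocycleSymbol_kernelIncl_of_snd_eq_one hγ _ hn, mul_one] at h1
  exact h1.symm

theorem conj_mem_kernelK (u : U) {v : Q} (hv : v ∈ kernelK U γ hγ) :
    u.1.2 * v * u.1.2⁻¹ ∈ kernelK U γ hγ := by
  have e : (u * kernelIncl hγ ⟨v, hv⟩ * u⁻¹).1 = (1, u.1.2 * v * u.1.2⁻¹) :=
    Prod.ext (by simp [kernelIncl]) (by simp [kernelIncl])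
  refine (mem_kernelK_iff hγ).2 ⟨e ▸ (u * kernelIncl hγ ⟨v, hv⟩ * u⁻¹).2, fun n hn => ?_⟩
  have h1 := cocycleSymbol_mul_left hγ ⟨(n, 1), hn⟩ u (kernelIncl hγ ⟨v, hv⟩)
  -- Both (n, e)u and u lie over the same element of Q, so they have the same symbol with v.
  -- Cancelling it in γ(nu|v) = γ(n|uvu⁻¹) γ(u|v) leaves γ(n|uvu⁻¹) = 1.
  rw [cocycleSymbol_kernelIncl_congr hγ (u' := u) (one_mul _), right_eq_mul] at h1
  rw [← h1]
  congr 1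
  exact Subtype.ext e.symm

theorem conj_kernelIncl (u : U) (v : kernelK U γ hγ) :
    u * kernelIncl hγ v * u⁻¹ =
      kernelIncl hγ ⟨u.1.2 * v * u.1.2⁻¹, conj_mem_kernelK hγ u v.2⟩ :=
  Subtype.ext (Prod.ext (by simp [kernelIncl]) (by simp [kernelIncl]))

/-- An element of `U` lying over a given element of the projection of `U` to the second factor. -/
noncomputable def liftSnd (q : U.map (MonoidHom.snd G Q)) : U :=
  ⟨q.2.choose, q.2.choose_spec.1⟩

theorem liftSnd_snd (q : U.map (MonoidHom.snd G Q)) : (liftSnd q).1.2 = q :=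
  q.2.choose_spec.2

/-- The datum `(pr₂ U, K, γ|_K, ε)`. -/
noncomputable def kernelDatum : AlgDatum k Q where
  H := U.map (MonoidHom.snd G Q)
  F := kernelK U γ hγ
  le v hv := ⟨(1, v), (kernelIncl hγ ⟨v, hv⟩).2, rfl⟩
  conj_mem := by
    rintro _ ⟨u, hu, rfl⟩ v hv
    exact conj_mem_kernelK hγ ⟨u, hu⟩ hv
  γ v w := γ (kernelIncl hγ v) (kernelIncl hγ w)
  isCocycle :=
    { one_left := fun g => by rw [map_one, hγ.one_left]
      one_right := fun g => by rw [map_one, hγ.one_right]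
      cocycle := fun f g h => by rw [map_mul, map_mul, hγ.cocycle] }
  ε q v := cocycleSymbol γ (liftSnd q) (kernelIncl hγ v)
  eps_mul g h v := by
    -- The chosen lifts need not be multiplicative. The lift of gh may be replaced by the product of
    -- lifts, and the identity becomes the one for γ(·|·) on U.
    rw [cocycleSymbol_kernelIncl_congr hγ (u' := liftSnd g * liftSnd h)
      (by simp [liftSnd_snd]), cocycleSymbol_mul_left hγ, conj_kernelIncl]
    simp only [liftSnd_snd]
  eps_coboundary h v w := by
    rw [map_mul, cocycleSymbol_mul_right hγ, conj_kernelIncl, conj_kernelIncl]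
    simp only [liftSnd_snd]
  eps_comm v w := by
    -- An element v of K has the preferred lift (e, v); with it the identity is the definition of
    -- the symbol.
    rw [cocycleSymbol_kernelIncl_congr hγ (u' := kernelIncl hγ v) (by rw [liftSnd_snd]; rfl),
      map_mul, map_mul, map_inv, cocycleSymbol, inv_mul_cancel_right]

theorem kernelDatum_ε {q : (kernelDatum hγ).H} {u : U} (h : u.1.2 = q)
    (v : (kernelDatum hγ).F) : (kernelDatum hγ).ε q v = cocycleSymbol γ u (kernelIncl hγ v) :=
  cocycleSymbol_kernelIncl_congr hγ ((liftSnd_snd q).trans h.symm) v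

end KernelDatum

/-! ### Generators and relations of the two algebras, and the map back from A(U, γ). -/

section Generators

variable {k G Q : Type u} [Field k] [Group G] [Group Q] {U : Subgroup (G × Q)}
  {γ : U → U → kˣ} (hγ : IsNormCocycle γ)

/-- The generators of `A(U, γ)`, indexed by `U`. -/
noncomputable def pairGen (x : G × Q) (u : U) : (AlgDatum.ofPair U γ hγ).Carrier :=
  (AlgDatum.ofPair U γ hγ).a x u

theorem pairGen_mul (x : G × Q) (h u : U) : pairGen hγ (x * h) u =
    (cocycleSymbol γ h u : k) • pairGen hγ x (h * u * h⁻¹) :=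
  (AlgDatum.ofPair U γ hγ).a_mul x h u

theorem pairGen_act (x y : G × Q) (u : U) :
    (AlgDatum.ofPair U γ hγ).act x (pairGen hγ y u) = pairGen hγ (x * y) u :=
  (AlgDatum.ofPair U γ hγ).act_a x y u

theorem pairGen_mul_same (x : G × Q) (u u' : U) :
    (AlgDatum.ofPair U γ hγ).mul (pairGen hγ x u) (pairGen hγ x u') =
      (γ u u' : k) • pairGen hγ x (u * u') :=
  (AlgDatum.ofPair U γ hγ).mul_a_same x u u'

theorem pairGen_mul_ne {x y : G × Q} (h : x⁻¹ * y ∉ U) (u u' : U) :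
    (AlgDatum.ofPair U γ hγ).mul (pairGen hγ x u) (pairGen hγ y u') = 0 :=
  (AlgDatum.ofPair U γ hγ).mul_a_ne h u u'

theorem pairGen_mem_gr {x y : G × Q} {u : U} (h : x * u * x⁻¹ = y) :
    pairGen hγ x u ∈ (AlgDatum.ofPair U γ hγ).gr y :=
  Submodule.subset_span ⟨x, u, h, rfl⟩

theorem pair_gr_le {x : G × Q} {S : Submodule k (AlgDatum.ofPair U γ hγ).Carrier}
    (h : ∀ (y : G × Q) (u : U), y * u * y⁻¹ = x → pairGen hγ y u ∈ S) :
    (AlgDatum.ofPair U γ hγ).gr x ≤ S :=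
  AlgDatum.gr_le h

/-- The generators of the algebra of `kernelDatum`, indexed by the kernel. -/
noncomputable def kernelGen (q : Q) (v : kernelK U γ hγ) : (kernelDatum hγ).Carrier :=
  (kernelDatum hγ).a q v

/-- The relation is indexed by u in U instead of its projection, with the scalar read off from u
itself. In this form it matches the relation in A(U, γ) term by term. -/
theorem kernelGen_mul (q : Q) (u : U) (v : kernelK U γ hγ) : kernelGen hγ (q * u.1.2) v =
    (cocycleSymbol γ u (kernelIncl hγ v) : k) •
      kernelGen hγ q ⟨u.1.2 * v * u.1.2⁻¹, conj_mem_kernelK hγ u v.2⟩ := by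
  refine ((kernelDatum hγ).a_mul q ⟨u.1.2, u.1, u.2, rfl⟩ v).trans ?_
  exact congrArg (fun c : kˣ => (c : k) • kernelGen hγ q _) (kernelDatum_ε hγ (u := u) rfl v)

theorem kernelGen_act (q r : Q) (v : kernelK U γ hγ) :
    (kernelDatum hγ).act q (kernelGen hγ r v) = kernelGen hγ (q * r) v :=
  (kernelDatum hγ).act_a q r v

theorem kernelGen_mul_same (q : Q) (v w : kernelK U γ hγ) :
    (kernelDatum hγ).mul (kernelGen hγ q v) (kernelGen hγ q w) =
      (γ (kernelIncl hγ v) (kernelIncl hγ w) : k) • kernelGen hγ q (v * w) :=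
  (kernelDatum hγ).mul_a_same q v w

theorem kernelGen_mul_ne {q r : Q} (h : q⁻¹ * r ∉ U.map (MonoidHom.snd G Q))
    (v w : kernelK U γ hγ) :
    (kernelDatum hγ).mul (kernelGen hγ q v) (kernelGen hγ r w) = 0 :=
  (kernelDatum hγ).mul_a_ne h v w

theorem exists_kernelGen_eq {q r : Q} (h : q⁻¹ * r ∈ U.map (MonoidHom.snd G Q))
    (v : kernelK U γ hγ) :
    ∃ (c : k) (w : kernelK U γ hγ), kernelGen hγ r v = c • kernelGen hγ q w :=
  (kernelDatum hγ).exists_a_eq h v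

theorem kernelGen_mem_gr {q r : Q} {v : kernelK U γ hγ} (h : q * v * q⁻¹ = r) :
    kernelGen hγ q v ∈ (kernelDatum hγ).gr r :=
  Submodule.subset_span ⟨q, v, h, rfl⟩

theorem kernel_gr_le {q : Q} {S : Submodule k (kernelDatum hγ).Carrier}
    (h : ∀ (r : Q) (v : kernelK U γ hγ), r * v * r⁻¹ = q → kernelGen hγ r v ∈ S) :
    (kernelDatum hγ).gr q ≤ S :=
  AlgDatum.gr_le h

theorem kernel_lin_ext {W : Type*} [AddCommGroup W] [Module k W]
    {φ ψ : (kernelDatum hγ).Carrier →ₗ[k] W}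
    (h : ∀ q v, φ (kernelGen hγ q v) = ψ (kernelGen hγ q v)) : φ = ψ :=
  AlgDatum.lin_ext h

open Classical in
/-- The linear map `a_{(g,q),(e,v)} ↦ a_{q,v}` for `v` in the kernel, vanishing on the other
generators. -/
noncomputable def ofInvariants :
    (AlgDatum.ofPair U γ hγ).Carrier →ₗ[k] (kernelDatum hγ).Carrier :=
  (AlgDatum.ofPair U γ hγ).lift
    (fun x u => if h : u.1.1 = 1 ∧ u.1.2 ∈ kernelK U γ hγ then
      kernelGen hγ x.2 ⟨u.1.2, h.2⟩ else 0)
    (fun x (h : U) (u : U) => by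
      -- The condition is invariant under conjugation by U, so both sides of the relation are
      -- defined by the same branch. On the kernel branch the relation is `kernelGen_mul`.
      by_cases hu : u.1.1 = 1 ∧ u.1.2 ∈ kernelK U γ hγ
      · have hu' : (h * u * h⁻¹).1.1 = 1 ∧ (h * u * h⁻¹).1.2 ∈ kernelK U γ hγ :=
          ⟨by simp [hu.1], conj_mem_kernelK hγ h hu.2⟩
        have e : u = kernelIncl hγ ⟨u.1.2, hu.2⟩ := Subtype.ext (Prod.ext hu.1 rfl)
        refine (dif_pos hu).trans (Eq.trans ?_ (congrArg _ (dif_pos hu').symm))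
        have h1 := kernelGen_mul hγ x.2 h ⟨u.1.2, hu.2⟩
        rw [← e] at h1
        exact h1
      · have hu' : ¬ ((h * u * h⁻¹).1.1 = 1 ∧ (h * u * h⁻¹).1.2 ∈ kernelK U γ hγ) := by
          rintro ⟨h1, h2⟩
          refine hu ⟨by simpa using h1, ?_⟩
          -- Conjugating back by h⁻¹ shows that u satisfies the condition as soon as its conjugate
          -- does.
          have := conj_mem_kernelK hγ h⁻¹ h2
          simpa [mul_assoc] using this
        refine (dif_neg hu).trans (Eq.trans ?_ (congrArg _ (dif_neg hu').symm))
        rw [smul_zero])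

theorem ofInvariants_kernelIncl (x : G × Q) (v : kernelK U γ hγ) :
    ofInvariants hγ (pairGen hγ x (kernelIncl hγ v)) =
      kernelGen hγ x.2 v :=
  ((AlgDatum.ofPair U γ hγ).lift_a _ _ x _).trans (dif_pos ⟨rfl, v.2⟩)

theorem ofInvariants_eq_zero (x : G × Q) {u : U}
    (hu : ¬ (u.1.1 = 1 ∧ u.1.2 ∈ kernelK U γ hγ)) :
    ofInvariants hγ (pairGen hγ x u) = 0 :=
  ((AlgDatum.ofPair U γ hγ).lift_a _ _ x _).trans (dif_neg hu)

theorem ofInvariants_mem_gr {q : Q} {x : (AlgDatum.ofPair U γ hγ).Carrier}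
    (hx : x ∈ (AlgDatum.ofPair U γ hγ).gr (1, q)) :
    ofInvariants hγ x ∈ (kernelDatum hγ).gr q := by
  have : (AlgDatum.ofPair U γ hγ).gr (1, q) ≤
      ((kernelDatum hγ).gr q).comap (ofInvariants hγ) := by
    refine pair_gr_le hγ fun y u hy => ?_
    rw [Submodule.mem_comap]
    by_cases hK : u.1.1 = 1 ∧ u.1.2 ∈ kernelK U γ hγ
    · have e : u = kernelIncl hγ ⟨u.1.2, hK.2⟩ := Subtype.ext (Prod.ext hK.1 rfl)
      rw [e, ofInvariants_kernelIncl]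
      exact kernelGen_mem_gr hγ (congrArg Prod.snd hy)
    · rw [ofInvariants_eq_zero hγ y hK]
      exact Submodule.zero_mem _
  exact this hx

end Generators

/-! ### Symmetrisation over G and its compatibility with grading, action and product. -/

section SymSum

variable {k G Q : Type u} [Field k] [Group G] [Group Q] [Fintype G] {U : Subgroup (G × Q)}
  {γ : U → U → kˣ} (hγ : IsNormCocycle γ)


/-- The operator `∑ g, (g, e)` on `A(U, γ)`. -/
noncomputable def symSum :
    (AlgDatum.ofPair U γ hγ).Carrier →ₗ[k] (AlgDatum.ofPair U γ hγ).Carrier :=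
  ∑ g : G, (AlgDatum.ofPair U γ hγ).act (g, 1)

theorem symSum_apply (x : (AlgDatum.ofPair U γ hγ).Carrier) :
    symSum hγ x = ∑ g : G, (AlgDatum.ofPair U γ hγ).act (g, 1) x := by
  rw [symSum, LinearMap.sum_apply]

theorem symSum_act (g : G) (x : (AlgDatum.ofPair U γ hγ).Carrier) :
    symSum hγ ((AlgDatum.ofPair U γ hγ).act (g, 1) x) = symSum hγ x := by
  rw [symSum_apply, symSum_apply]
  refine Fintype.sum_equiv (Equiv.mulRight g) _ _ fun h => ?_
  rw [← Module.End.mul_apply, ← map_mul, Prod.mk_mul_mk, one_mul]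
  rfl

theorem act_symSum (g : G) (x : (AlgDatum.ofPair U γ hγ).Carrier) :
    (AlgDatum.ofPair U γ hγ).act (g, 1) (symSum hγ x) = symSum hγ x := by
  rw [symSum_apply, map_sum]
  refine Fintype.sum_equiv (Equiv.mulLeft g) _ _ fun h => ?_
  rw [← Module.End.mul_apply, ← map_mul, Prod.mk_mul_mk, one_mul]
  rfl

theorem symSum_of_invariant {x : (AlgDatum.ofPair U γ hγ).Carrier}
    (hx : ∀ g : G, (AlgDatum.ofPair U γ hγ).act (g, 1) x = x) :
    symSum hγ x = (Fintype.card G : k) • x := by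
  rw [symSum_apply, Finset.sum_congr rfl fun g _ => hx g, Finset.sum_const, Finset.card_univ,
    Nat.cast_smul_eq_nsmul]

/-- As x = (x₁, e)(e, x₂), the translation by x₁ is absorbed into the sum over G. -/
theorem symSum_a (x : G × Q) (u : U) : symSum hγ (pairGen hγ x u) =
    symSum hγ (pairGen hγ (1, x.2) u) := by
  rw [← symSum_act hγ x.1 (pairGen hγ (1, x.2) u), pairGen_act,
    Prod.mk_mul_mk, one_mul, mul_one]

/-- The symmetrisation vanishes on generators outside of the kernel of the pairing. -/
theorem symSum_a_eq_zero (x : G × Q) {u : U} (hu : u.1.1 = 1)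
    (hK : u.1.2 ∉ kernelK U γ hγ) : symSum hγ (pairGen hγ x u) = 0 := by
  obtain ⟨⟨g, v⟩, h⟩ := u
  obtain rfl : g = 1 := hu
  rw [mem_kernelK_iff] at hK
  push Not at hK
  obtain ⟨n, hn, hne⟩ := hK h
  -- Take n with γ(n|v) ≠ 1. The relation for n relates a_{xn,v} and a_{x,v} by this scalar, while
  -- `symSum_a` gives them the same symmetrisation. So the symmetrisation is fixed by a scalar other
  -- than 1.
  have h1 := congrArg (symSum hγ) (pairGen_mul hγ x ⟨(n, 1), hn⟩ ⟨(1, v), h⟩)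
  have h2 : (⟨(n, 1), hn⟩ * ⟨(1, v), h⟩ * ⟨(n, 1), hn⟩⁻¹ : U) = ⟨(1, v), h⟩ := by
    ext <;> simp
  rw [h2, map_smul, symSum_a, symSum_a hγ x] at h1
  simp only [Prod.snd_mul, mul_one] at h1
  rw [symSum_a]
  have h3 : ((cocycleSymbol γ ⟨(n, 1), hn⟩ ⟨(1, v), h⟩ : k) - 1) •
      symSum hγ (pairGen hγ (1, x.2) (⟨(1, v), h⟩ : U)) = 0 := by
    rw [sub_smul, one_smul, ← h1, sub_self]
  refine (smul_eq_zero.1 h3).resolve_left fun h4 => hne ?_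
  exact Units.ext (sub_eq_zero.1 h4)

/-- The linear map `a_{q,v} ↦ ∑ g, a_{(g,q),(e,v)}`. -/
noncomputable def toInvariants :
    (kernelDatum hγ).Carrier →ₗ[k] (AlgDatum.ofPair U γ hγ).Carrier :=
  (kernelDatum hγ).lift
    (fun q v => symSum hγ (pairGen hγ (1, q) (kernelIncl hγ v)))
    (fun q (h : U.map (MonoidHom.snd G Q)) (v : kernelK U γ hγ) => by
      -- The relation is the symmetrised relation of A(U, γ) for a lift of h; the G-coordinate of
      -- the lift disappears by `symSum_a`.
      have h1 := congrArg (symSum hγ) (pairGen_mul hγ (1, q) (liftSnd h) (kernelIncl hγ v))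
      rw [symSum_a, map_smul, conj_kernelIncl] at h1
      simp only [Prod.snd_mul, liftSnd_snd] at h1
      exact h1)

theorem toInvariants_a (q : Q) (v : kernelK U γ hγ) :
    toInvariants hγ (kernelGen hγ q v) =
      symSum hγ (pairGen hγ (1, q) (kernelIncl hγ v)) :=
  (kernelDatum hγ).lift_a _ _ q v

/-- Each of the |G| summands a_{(g,q),(e,v)} is sent to the same generator a_{q,v}. -/
theorem ofInvariants_toInvariants (x : (kernelDatum hγ).Carrier) :
    ofInvariants hγ (toInvariants hγ x) = (Fintype.card G : k) • x := by
  have : ofInvariants hγ ∘ₗ toInvariants hγ = (Fintype.card G : k) • LinearMap.id := by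
    refine kernel_lin_ext hγ fun q v => ?_
    rw [LinearMap.comp_apply, toInvariants_a, symSum_apply, map_sum,
      Finset.sum_congr rfl (g := fun _ => kernelGen hγ q v), Finset.sum_const,
      Finset.card_univ, ← Nat.cast_smul_eq_nsmul k]
    · rfl
    · intro g _
      rw [pairGen_act, ofInvariants_kernelIncl]
      simp
  exact LinearMap.congr_fun this x

/-- Generators of degree in {e} × Q have u = (e, v). For v in K both sides are the sum S(q, v). For
other v the left side is zero by construction and the right side by `symSum_a_eq_zero`; this is
where the passage from U ∩ ({e} × Q) to K takes place. -/
theorem toInvariants_ofInvariants {x : (AlgDatum.ofPair U γ hγ).Carrier}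
    (hx : x ∈ ⨆ q : Q, (AlgDatum.ofPair U γ hγ).gr (1, q)) :
    toInvariants hγ (ofInvariants hγ x) = symSum hγ x := by
  have : (⨆ q : Q, (AlgDatum.ofPair U γ hγ).gr (1, q)) ≤
      LinearMap.eqLocus (toInvariants hγ ∘ₗ ofInvariants hγ) (symSum hγ) := by
    refine iSup_le fun q => pair_gr_le hγ fun y u hy => ?_
    have hu : u.1.1 = 1 := by
      have := congrArg Prod.fst hy
      simpa using this
    rw [LinearMap.mem_eqLocus, LinearMap.comp_apply]
    by_cases hK : u.1.2 ∈ kernelK U γ hγ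
    · have e : u = kernelIncl hγ ⟨u.1.2, hK⟩ := Subtype.ext (Prod.ext hu rfl)
      rw [e, ofInvariants_kernelIncl, toInvariants_a, symSum_a hγ y]
    · rw [ofInvariants_eq_zero hγ y fun h => hK h.2, map_zero, symSum_a_eq_zero hγ y hu hK]
  exact this hx

theorem toInvariants_mem_gr {q : Q} {x : (kernelDatum hγ).Carrier}
    (hx : x ∈ (kernelDatum hγ).gr q) :
    toInvariants hγ x ∈ (AlgDatum.ofPair U γ hγ).gr (1, q) := by
  have : (kernelDatum hγ).gr q ≤
      ((AlgDatum.ofPair U γ hγ).gr (1, q)).comap (toInvariants hγ) := by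
    refine kernel_gr_le hγ fun r v hr => ?_
    rw [Submodule.mem_comap, toInvariants_a, symSum_apply]
    refine Submodule.sum_mem _ fun g _ => ?_
    rw [pairGen_act]
    refine pairGen_mem_gr hγ ?_
    rw [← hr]
    ext <;> simp [kernelIncl]
  exact this hx

theorem act_toInvariants (g : G) (x : (kernelDatum hγ).Carrier) :
    (AlgDatum.ofPair U γ hγ).act (g, 1) (toInvariants hγ x) = toInvariants hγ x := by
  have : (AlgDatum.ofPair U γ hγ).act (g, 1) ∘ₗ toInvariants hγ = toInvariants hγ :=
    kernel_lin_ext hγ fun q v => by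
      rw [LinearMap.comp_apply, toInvariants_a, act_symSum]
  exact LinearMap.congr_fun this x

theorem toInvariants_act (q : Q) (x : (kernelDatum hγ).Carrier) :
    toInvariants hγ ((kernelDatum hγ).act q x) =
      (AlgDatum.ofPair U γ hγ).act (1, q) (toInvariants hγ x) := by
  have : toInvariants hγ ∘ₗ (kernelDatum hγ).act q =
      (AlgDatum.ofPair U γ hγ).act (1, q) ∘ₗ toInvariants hγ :=
    kernel_lin_ext hγ fun r v => by
      rw [LinearMap.comp_apply, LinearMap.comp_apply, kernelGen_act, toInvariants_a,
        toInvariants_a, symSum_apply, symSum_apply, map_sum]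
      refine Finset.sum_congr rfl fun g _ => ?_
      rw [pairGen_act, pairGen_act, pairGen_act]
      congr 1
      ext <;> simp
  exact LinearMap.congr_fun this x

/-- A projection formula: the second factor is invariant, so (g x)(∑ y) = g (x (∑ y)) for each g. It
reduces a double sum over G to a single one. -/
theorem mul_symSum_symSum (x y : (AlgDatum.ofPair U γ hγ).Carrier) :
    (AlgDatum.ofPair U γ hγ).mul (symSum hγ x) (symSum hγ y) =
      symSum hγ ((AlgDatum.ofPair U γ hγ).mul x (symSum hγ y)) := by
  rw [symSum_apply hγ x, map_sum, LinearMap.sum_apply,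
    symSum_apply hγ ((AlgDatum.ofPair U γ hγ).mul x (symSum hγ y))]
  refine Finset.sum_congr rfl fun g _ => ?_
  rw [← AlgDatum.mul_act, act_symSum]

/-- The elements (g, q) and (e, q) lie in the same coset of U exactly when (g, e) is in U; other
terms multiply to zero. For such g the symbol with w is trivial, so a_{(g,q),w} = a_{(e,q),w} and
each surviving term contributes γ(v, w) a_{(e,q),vw}. -/
theorem mul_a_symSum_a (q : Q) (v w : kernelK U γ hγ) :
    (AlgDatum.ofPair U γ hγ).mul (pairGen hγ (1, q) (kernelIncl hγ v))
        (symSum hγ (pairGen hγ (1, q) (kernelIncl hγ w))) =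
      (Nat.card (U.comap (MonoidHom.inl G Q)) : k) •
        (γ (kernelIncl hγ v) (kernelIncl hγ w) : k) •
          pairGen hγ (1, q) (kernelIncl hγ (v * w)) := by
  classical
  rw [symSum_apply, map_sum, Finset.sum_congr rfl (g := fun g =>
    if g ∈ U.comap (MonoidHom.inl G Q) then (γ (kernelIncl hγ v) (kernelIncl hγ w) : k) •
      pairGen hγ (1, q) (kernelIncl hγ (v * w)) else 0)]
  · rw [← Finset.sum_filter, Finset.sum_const, Nat.cast_smul_eq_nsmul, Nat.card_eq_fintype_card,
      Fintype.card_subtype]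
  · intro g _
    rw [pairGen_act]
    split_ifs with hg
    · have h1 := pairGen_mul hγ (1, q) ⟨(g, 1), hg⟩ (kernelIncl hγ w)
      rw [cocycleSymbol_kernelIncl_of_snd_eq_one hγ _ rfl,
        conj_kernelIncl_of_snd_eq_one hγ _ rfl, Units.val_one, one_smul] at h1
      have e : ((g, 1) * (1, q) : G × Q) = (1, q) * (g, 1) := by ext <;> simp
      rw [e, h1, map_mul]
      exact pairGen_mul_same hγ _ _ _
    · refine pairGen_mul_ne hγ (fun h => hg ?_) _ _
      have e : ((1, q)⁻¹ * ((g, 1) * (1, q)) : G × Q) = (g, 1) := by ext <;> simp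
      rw [e] at h
      exact h

theorem toInvariants_mul (x y : (kernelDatum hγ).Carrier) :
    (AlgDatum.ofPair U γ hγ).mul (toInvariants hγ x) (toInvariants hγ y) =
      (Nat.card (U.comap (MonoidHom.inl G Q)) : k) •
        toInvariants hγ ((kernelDatum hγ).mul x y) := by
  have : (AlgDatum.ofPair U γ hγ).mul.compl₁₂ (toInvariants hγ) (toInvariants hγ) =
      (Nat.card (U.comap (MonoidHom.inl G Q)) : k) •
        (kernelDatum hγ).mul.compr₂ (toInvariants hγ) := by
    refine kernel_lin_ext hγ fun q v => kernel_lin_ext hγ fun r w => ?_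
    simp only [LinearMap.compl₁₂_apply, LinearMap.smul_apply, LinearMap.compr₂_apply]
    -- Within one coset of pr₂ U, the relations move both generators to the same q. If the cosets
    -- differ, then (g, q) and (g', r) are in different cosets of U for all g, g', so every term
    -- vanishes.
    by_cases h : q⁻¹ * r ∈ U.map (MonoidHom.snd G Q)
    · obtain ⟨c, w', hc⟩ := exists_kernelGen_eq hγ h w
      rw [hc]
      simp only [map_smul]
      rw [smul_comm _ c, kernelGen_mul_same, map_smul, toInvariants_a, toInvariants_a,
        toInvariants_a, mul_symSum_symSum, mul_a_symSum_a, map_smul, map_smul]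
    · rw [kernelGen_mul_ne hγ h, map_zero, smul_zero, toInvariants_a, toInvariants_a,
        symSum_apply, symSum_apply, map_sum]
      refine Finset.sum_eq_zero fun g' _ => ?_
      rw [map_sum, LinearMap.sum_apply]
      refine Finset.sum_eq_zero fun g _ => ?_
      rw [pairGen_act, pairGen_act]
      exact pairGen_mul_ne hγ (fun h' => h ⟨_, h', by simp⟩) _ _
  exact LinearMap.congr_fun (LinearMap.congr_fun this x) y

end SymSum

/-! ### Algebra isomorphisms, and the product of the parent in concrete terms. -/

section Algebras

namespace ZCat

variable {k G : Type u} [Field k] [Group G] [Finite G]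

theorem one_mul_apply (A : Mon (ZCat k G)) (x : A.X) :
    Hom.lin (MonObj.mul (X := A.X))
      (Hom.lin (MonObj.one (X := A.X)) (1 : k) ⊗ₜ[k] x) = x := by
  have h := LinearMap.congr_fun (congrArg Hom.lin (MonObj.one_mul A.X)) ((1 : k) ⊗ₜ[k] x)
  exact h.trans (one_smul k x)

theorem mul_one_apply (A : Mon (ZCat k G)) (x : A.X) :
    Hom.lin (MonObj.mul (X := A.X))
      (x ⊗ₜ[k] Hom.lin (MonObj.one (X := A.X)) (1 : k)) = x := by
  have h := LinearMap.congr_fun (congrArg Hom.lin (MonObj.mul_one A.X)) (x ⊗ₜ[k] (1 : k))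
  exact h.trans (one_smul k x)

/-- An isomorphism in `Z(G)` which is multiplicative is an isomorphism of algebras. -/
noncomputable def monIso {A B : Mon (ZCat k G)} (e : A.X ≅ B.X)
    (h : ∀ x y : A.X, Hom.lin e.hom (Hom.lin (MonObj.mul (X := A.X)) (x ⊗ₜ[k] y)) =
      Hom.lin (MonObj.mul (X := B.X)) (Hom.lin e.hom x ⊗ₜ[k] Hom.lin e.hom y)) : A ≅ B :=
  Mon.mkIso e
    (hom_ext (LinearMap.ext_ring (by
      change Hom.lin e.hom (Hom.lin (MonObj.one (X := A.X)) (1 : k)) =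
        Hom.lin (MonObj.one (X := B.X)) (1 : k)
      have hs : ∀ y : B.X, Hom.lin e.hom (Hom.lin e.inv y) = y := fun y =>
        LinearMap.congr_fun (congrArg Hom.lin e.inv_hom_id) y
      -- The image of the unit is a unit by surjectivity: e(1) = e(1)·1 = e(1)·e(e⁻¹(1)) =
      -- e(1·e⁻¹(1)) = 1.
      rw [← mul_one_apply B (Hom.lin e.hom _), ← hs (Hom.lin (MonObj.one (X := B.X)) (1 : k)),
        ← h, one_mul_apply])))
    (hom_ext (TensorProduct.ext' h))

end ZCat

/-- The product of the parent is defined through the adjunction. Its counit is 1 ⊗ x ↦ 1 • x, so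
unwinding the lax structure leaves the restriction of the product of A to the invariants. -/
theorem ZCat.parent_mul_tmul {k G Q : Type u} [Field k] [Group G] [Group Q] [Finite G] [Finite Q]
    (A : Mon (ZCat k (G × Q))) (x y : ZCat.homOneSub A.X) :
    (ZCat.homOneSub A.X).subtype
        (ZCat.Hom.lin (MonObj.mul (X := (ZCat.parent A).X)) (x ⊗ₜ[k] y)) =
      ZCat.Hom.lin (MonObj.mul (X := A.X)) ((x : A.X) ⊗ₜ[k] (y : A.X)) := by
  change ZCat.Hom.lin (MonObj.mul (X := A.X))
    (((1 : k) • (x : A.X)) ⊗ₜ[k] ((1 : k) • (y : A.X))) = _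
  rw [one_smul, one_smul]

end Algebras

/-! ### The normalised isomorphism onto the parent. -/

section ParentIso

variable {k G Q : Type u} [Field k] [Group G] [Fintype G] [Group Q]
  {U : Subgroup (G × Q)} {γ : U → U → kˣ} (hγ : IsNormCocycle γ)

theorem toInvariants_mem_iSup [Finite Q] (x : (kernelDatum hγ).Carrier) :
    toInvariants hγ x ∈ ⨆ q : Q, (AlgDatum.ofPair U γ hγ).gr (1, q) := by
  have h : (⨆ q, (kernelDatum hγ).gr q) ≤
      (⨆ q : Q, (AlgDatum.ofPair U γ hγ).gr (1, q)).comap (toInvariants hγ) :=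
    iSup_le fun q y hy => Submodule.mem_iSup_of_mem q (toInvariants_mem_gr hγ hy)
  have h' : (⨆ q, (kernelDatum hγ).gr q) = ⊤ := (kernelDatum hγ).obj.iSup_eq_top
  exact h (h' ▸ Submodule.mem_top)

/-- The scaled symmetrisation `a_{q,v} ↦ |U ∩ (G × {e})|⁻¹ ∑ g, a_{(g,q),(e,v)}`. -/
noncomputable def normalizedTo :
    (kernelDatum hγ).Carrier →ₗ[k] (AlgDatum.ofPair U γ hγ).Carrier :=
  (Nat.card (U.comap (MonoidHom.inl G Q)) : k)⁻¹ • toInvariants hγ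

/-- The scaling of `ofInvariants` which is inverse to `normalizedTo` on invariants. -/
noncomputable def normalizedOf :
    (AlgDatum.ofPair U γ hγ).Carrier →ₗ[k] (kernelDatum hγ).Carrier :=
  ((Nat.card (U.comap (MonoidHom.inl G Q)) : k) * (Fintype.card G : k)⁻¹) • ofInvariants hγ

theorem card_comap_inl_ne_zero [CharZero k] : (Nat.card (U.comap (MonoidHom.inl G Q)) : k) ≠ 0 :=
  Nat.cast_ne_zero.2 Nat.card_pos.ne'

theorem normalizedOf_normalizedTo [CharZero k] (x : (kernelDatum hγ).Carrier) :
    normalizedOf hγ (normalizedTo hγ x) = x := by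
  have hG : (Fintype.card G : k) ≠ 0 := Nat.cast_ne_zero.2 Fintype.card_ne_zero
  rw [normalizedOf, normalizedTo, LinearMap.smul_apply, LinearMap.smul_apply, map_smul,
    ofInvariants_toInvariants, smul_smul, smul_smul, mul_right_comm,
    inv_mul_cancel_right₀ hG, mul_inv_cancel₀ card_comap_inl_ne_zero, one_smul]

theorem normalizedTo_normalizedOf [CharZero k] {x : (AlgDatum.ofPair U γ hγ).Carrier}
    (hx : x ∈ ⨆ q : Q, (AlgDatum.ofPair U γ hγ).gr (1, q))
    (hx' : ∀ g : G, (AlgDatum.ofPair U γ hγ).act (g, 1) x = x) :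
    normalizedTo hγ (normalizedOf hγ x) = x := by
  have hG : (Fintype.card G : k) ≠ 0 := Nat.cast_ne_zero.2 Fintype.card_ne_zero
  rw [normalizedOf, normalizedTo, LinearMap.smul_apply, LinearMap.smul_apply, map_smul,
    toInvariants_ofInvariants hγ hx, symSum_of_invariant hγ hx', smul_smul, smul_smul,
    inv_mul_cancel_left₀ card_comap_inl_ne_zero, inv_mul_cancel₀ hG, one_smul]

theorem normalizedTo_act (q : Q) (x : (kernelDatum hγ).Carrier) :
    normalizedTo hγ ((kernelDatum hγ).act q x) =
      (AlgDatum.ofPair U γ hγ).act (1, q) (normalizedTo hγ x) := by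
  rw [normalizedTo, LinearMap.smul_apply, LinearMap.smul_apply, toInvariants_act, map_smul]

/-- If T(x) T(y) = c T(xy), then c⁻¹ T is multiplicative; here c = |U ∩ (G × {e})|, nonzero in
characteristic zero. -/
theorem normalizedTo_mul [CharZero k] (x y : (kernelDatum hγ).Carrier) :
    normalizedTo hγ ((kernelDatum hγ).mul x y) =
      (AlgDatum.ofPair U γ hγ).mul (normalizedTo hγ x) (normalizedTo hγ y) := by
  rw [normalizedTo, LinearMap.smul_apply, LinearMap.smul_apply, LinearMap.smul_apply, map_smul,
    map_smul, LinearMap.smul_apply, toInvariants_mul, inv_smul_smul₀ card_comap_inl_ne_zero]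

theorem normalizedTo_mem [Finite Q] (x : (kernelDatum hγ).Carrier) :
    normalizedTo hγ x ∈ ZCat.homOneSub (AlgDatum.ofPair U γ hγ).obj :=
  Submodule.smul_mem (ZCat.homOneSub (AlgDatum.ofPair U γ hγ).obj) _
    ⟨toInvariants_mem_iSup hγ x, (Representation.mem_invariants _ _).2 fun g =>
      act_toInvariants hγ g x⟩

/-- The algebra of `kernelDatum` is linearly isomorphic to the invariants of `A(U, γ)`. -/
noncomputable def invariantsEquiv [CharZero k] [Finite Q] : (kernelDatum hγ).Carrier ≃ₗ[k]
    ZCat.homOneSub (AlgDatum.ofPair U γ hγ).obj :=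
  LinearEquiv.ofLinearMap
    ((normalizedTo hγ).codRestrict (ZCat.homOneSub (AlgDatum.ofPair U γ hγ).obj)
      (normalizedTo_mem hγ))
    (normalizedOf hγ ∘ₗ (ZCat.homOneSub (AlgDatum.ofPair U γ hγ).obj).subtype)
    (LinearMap.ext fun x => Subtype.ext
      (normalizedTo_normalizedOf hγ x.2.1 (ZCat.act_eq_of_mem_homOneSub x.2)))
    (LinearMap.ext (normalizedOf_normalizedTo hγ))

/-- The isomorphism of objects of `Z(Q)` underlying `parentIso`. -/
noncomputable def parentObjIso [CharZero k] [Finite Q] :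
    (kernelDatum hγ).alg.X ≅ (ZCat.parent (AlgDatum.ofPair U γ hγ).alg).X :=
  ZCat.isoOfEquiv (X := (kernelDatum hγ).obj)
    (Y := ZCat.homOneObj (AlgDatum.ofPair U γ hγ).obj) (invariantsEquiv hγ)
    (fun q _ hx => Submodule.smul_mem ((AlgDatum.ofPair U γ hγ).gr (1, q)) _
      (toInvariants_mem_gr hγ hx))
    (fun q _ hy => Submodule.smul_mem ((kernelDatum hγ).gr q) _ (ofInvariants_mem_gr hγ hy))
    (fun q x => Subtype.ext (normalizedTo_act hγ q x))

/-- The parent of `A(U, γ)` is the algebra of `kernelDatum`. -/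
noncomputable def parentIso [CharZero k] [Finite Q] :
    (kernelDatum hγ).alg ≅ ZCat.parent (AlgDatum.ofPair U γ hγ).alg :=
  ZCat.monIso (parentObjIso hγ) fun x y => Subtype.ext
    ((normalizedTo_mul hγ x y).trans (ZCat.parent_mul_tmul (AlgDatum.ofPair U γ hγ).alg
      (invariantsEquiv hγ x) (invariantsEquiv hγ y)).symm)

end ParentIso

/-- Normality of K and the three identities are part of `AlgDatum`. The formula for ε is required
for every u over q, which contains the independence of the choice of g. -/
theorem mainTheorem5 {k G Q : Type u} [Field k] [IsAlgClosed k] [CharZero k]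
    [Group G] [Finite G] [Group Q] [Finite Q]
    (U : Subgroup (G × Q)) (γ : U → U → kˣ) (hγ : IsNormCocycle γ) :
    ∃ D : AlgDatum k Q,
      D.H = U.map (MonoidHom.snd G Q) ∧
      D.F = kernelK U γ hγ ∧
      (∀ (v w : D.F) (v' w' : U), v'.1 = (1, v.1) → w'.1 = (1, w.1) → D.γ v w = γ v' w') ∧
      (∀ (q : D.H) (v : D.F) (u v' : U), u.1.2 = q.1 → v'.1 = (1, v.1) →
        D.ε q v = γ u v' * (γ (u * v' * u⁻¹) u)⁻¹) ∧
      Nonempty (ZCat.parent (AlgDatum.ofPair U γ hγ).alg ≅ D.alg) := by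
  have := Fintype.ofFinite G
  refine ⟨kernelDatum hγ, rfl, rfl, fun v w v' w' hv hw => ?_, fun q v u v' hu hv => ?_,
    ⟨(parentIso hγ).symm⟩⟩
  · obtain rfl : v' = kernelIncl hγ v := Subtype.ext hv
    obtain rfl : w' = kernelIncl hγ w := Subtype.ext hw
    rfl
  · obtain rfl : v' = kernelIncl hγ v := Subtype.ext hv
    exact kernelDatum_ε hγ hu v
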